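/- Let $\mathfrak g$ be a finite-dimensional complex simple Lie algebra with Cartan subalgebra $\mathfrak h$, simple roots $\alpha_1,\dots,\alpha_r$, invariant form $(\cdot,\cdot)$ on $\mathfrak h^*$ normalized by $(\alpha,\alpha)=2$ for short roots, $d_i=(\alpha_i,\alpha_i)/2$, Cartan matrix $(\alpha_i,\alpha_j)=d_ia_{ij}$, and half-sum of positive roots $\rho$. Let $q>0$, $q\neq1$ be real, $q_i=q^{d_i}$. Let $U_q(\mathfrak g)$ be the Hopf $*$-algebra generated by $E_i,F_i,K_i^{\pm1}$ with relations $K_iK_j=K_jK_i$, $K_iE_jK_i^{-1}=q_i^{a_{ij}}E_j$, $K_iF_jK_i^{-1}=q_i^{-a_{ij}}F_j$, $E_iF_j-F_jE_i=\delta_{ij}\frac{K_i-K_i^{-1}}{q_i-q_i^{-1}}$ and the quantum Serre relations, with $\Delta(K_i)=K_i\otimes K_i$, $\Delta(E_i)=E_i\otimes K_i+1\otimes E_i$, $\Delta(F_i)=F_i\otimes1+K_i^{-1}\otimes F_i$, antipode $S$, counit $\varepsilon$, and $K_i^*=K_i$, $E_i^*=K_iF_i$, $F_i^*=E_iK_i^{-1}$.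 For $2\rho=\sum_in_i\alpha_i$ put $K_{2\rho}=\prod_iK_i^{n_i}$. Let $\mathbb C_q[G]\subset U_q(\mathfrak g)^*$ be the $*$-algebra spanned by the matrix coefficients of the finite-dimensional (type 1, i.e. spanned by vectors of integral weight) representations of $U_q(\mathfrak g)$, with $(\phi\psi)(X)=(\phi\otimes\psi)(\Delta(X))$, $\phi^*(X)=\overline{\phi(S(X)^*)}$; it is a left and a right $U_q(\mathfrak g)$-module algebra by $(X\triangleright\phi)(Y)=\phi(YX)$ and $(\phi\triangleleft X)(Y)=\phi(XY)$. Let $\mathcal U$ be a Hopf algebra with bijective antipode and $\mathcal B$ a right (respectively left) $\mathcal U$-module algebra. Given anti-homomorphisms $\rho^\circ:\mathcal U\to\mathrm{Mat}_N(\mathbb C)$, $\sigma^\circ:\mathcal U\to\mathrm{Mat}_K(\mathbb C)$, a matrix $M\in\mathrm{Mat}_{N\times K}(\mathcal B)$ is called right (respectively left) invariant if for all $X\in\mathcal U$ $$\rho^\circ(X_{(1)})\,(M\triangleleft X_{(2)})\,\sigma^\circ(S^{-1}(X_{(3)}))=\varepsilon(X)M,$$ respectively $$\rho^\circ(S^{-1}(X_{(1)}))\,(S^{-2}(X_{(2)})\triangleright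 M)\,\sigma^\circ(X_{(3)})=\varepsilon(X)M .$$ An invariant projection is an idempotent $P\in\mathrm{Mat}_N(\mathcal B)$ with an anti-homomorphism $\rho^\circ$ for which $P$ is invariant (with $\sigma^\circ=\rho^\circ$). Two of them, $P$ and $P'$, are equivalent if $P=xy$, $P'=yx$ for invariant rectangular matrices $x,y$. The Grothendieck group of equivalence classes of right (respectively left) invariant projections under direct sum is denoted ${}^{\mathcal U}K_0(\mathcal B)$ (respectively $K_0(\mathcal B)^{\mathcal U}$). Let $\pi:U_q(\mathfrak g)\to\mathrm{End}(V(\Lambda))$ be a finite-dimensional irreducible representation of dominant integral highest weight $\Lambda$ that is unitary ($\langle\pi(X)v,w\rangle=\langle v,\pi(X^*)w\rangle$), let $v_1,\dots,v_N$ be an orthonormal basis with dual basis $f^1,\dots,f^N$, and let $u^i_j(X)=f^i(\pi(X)v_j)$. Define $\mathsf M^n_m,\mathsf N^n_m\in\mathrm{Mat}_N(\mathbb C_q[G])$ by $$(\mathsf M^n_m)^i_j=(u^m_i)^*u^n_j,\qquad(\mathsf N^n_m)^i_j=u^i_m(u^j_n)^*,$$ and, for $c^m_n\in\mathbb C$,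 let $\mathsf P=\sum_{m,n}c^m_n\mathsf M^n_m$ and $\mathsf Q=\sum_{m,n}c^m_n\mathsf N^n_m$. Then: 1) $\rho^\circ(X)=\pi(K_{2\rho}^{-1}S(X)K_{2\rho})$ (written as a matrix in the basis $v_i$) is an anti-homomorphism, every $\mathsf M^n_m$ is left $U_q(\mathfrak g)$-invariant with respect to it, and if $\mathsf P$ is a projection, then $\mathsf P$ with $\rho^\circ$ is a left invariant projection and so defines a class in $K_0(\mathbb C_q[G])^{U_q(\mathfrak g)}$. 2) $\rho^\circ(X)=\pi(K_{2\rho}S^{-1}(X)K_{2\rho}^{-1})$ is an anti-homomorphism, every $\mathsf N^n_m$ is right $U_q(\mathfrak g)$-invariant with respect to it, and if $\mathsf Q$ is a projection, then $\mathsf Q$ with $\rho^\circ$ is a right invariant projection and so defines a class in ${}^{U_q(\mathfrak g)}K_0(\mathbb C_q[G])$. -/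

import Mathlib

open scoped TensorProduct InnerProductSpace

noncomputable section

namespace QuantumGroup

/-! ### Quantum integers and the Serre expressions -/

/-- The `q`-integer `[n]_q = (q^n - q^{-n}) / (q - q^{-1})`. -/
def qInt (q : ℂ) (n : ℕ) : ℂ := (q ^ n - (q ^ n)⁻¹) / (q - q⁻¹)

/-- The `q`-factorial `[n]_q! = [1]_q [2]_q ⋯ [n]_q`. -/
def qFact (q : ℂ) (n : ℕ) : ℂ := ∏ k ∈ Finset.range n, qInt q (k + 1)

/-- The `q`-binomial coefficient (for `k ≤ n`). -/
def qBinom (q : ℂ) (n k : ℕ) : ℂ := qFact q n / (qFact q k * qFact q (n - k))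

/-- The quantum Serre expression `∑ₖ (-1)ᵏ [m choose k]_q e^{m-k} x eᵏ`. -/
def serre {R : Type*} [Ring R] [Algebra ℂ R] (q : ℂ) (m : ℕ) (e x : R) : R :=
  ∑ k ∈ Finset.range (m + 1), ((-1) ^ k * qBinom q m k) • (e ^ (m - k) * x * e ^ k)

section SerreLemmas

variable {R : Type*} [Ring R] [Algebra ℂ R]

theorem qInt_inv (q : ℂ) (n : ℕ) : qInt q⁻¹ n = qInt q n := by
  unfold qInt
  rw [inv_pow, inv_inv, inv_inv, ← neg_sub (q ^ n), ← neg_sub q, neg_div_neg_eq]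

theorem qBinom_inv (q : ℂ) (n k : ℕ) : qBinom q⁻¹ n k = qBinom q n k := by
  simp [qBinom, qFact, qInt_inv]

theorem qBinom_symm (q : ℂ) {n k : ℕ} (h : k ≤ n) : qBinom q n (n - k) = qBinom q n k := by
  simp [qBinom, Nat.sub_sub_self h, mul_comm]

theorem serre_inv (q : ℂ) (m : ℕ) (e x : R) : serre q⁻¹ m e x = serre q m e x := by
  simp [serre, qBinom_inv]

theorem qFact_succ (q : ℂ) (n : ℕ) : qFact q (n + 1) = qFact q n * qInt q (n + 1) := by
  simp [qFact, Finset.prod_range_succ]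

/-- `q` is nonzero and not a root of unity. -/
def Generic (q : ℂ) : Prop := q ≠ 0 ∧ ∀ n : ℕ, 0 < n → q ^ n ≠ 1

theorem Generic.inv {q : ℂ} (h : Generic q) : Generic q⁻¹ :=
  ⟨inv_ne_zero h.1, fun n hn => by
    rw [inv_pow, Ne, inv_eq_one]
    exact h.2 n hn⟩

theorem Generic.sub_ne {q : ℂ} (h : Generic q) : q - q⁻¹ ≠ 0 := by
  intro h0
  have h1 : q * (q - q⁻¹) = 0 := by rw [h0, mul_zero]
  rw [mul_sub, mul_inv_cancel₀ h.1] at h1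
  exact h.2 2 (by norm_num) (by linear_combination h1)

theorem Generic.qInt_ne {q : ℂ} (h : Generic q) {n : ℕ} (hn : 0 < n) : qInt q n ≠ 0 := by
  refine div_ne_zero ?_ h.sub_ne
  intro h0
  have h1 : q ^ n * (q ^ n - (q ^ n)⁻¹) = 0 := by rw [h0, mul_zero]
  rw [mul_sub, mul_inv_cancel₀ (pow_ne_zero _ h.1)] at h1
  exact h.2 (2 * n) (by omega) (by rw [two_mul, pow_add]; linear_combination h1)

theorem Generic.qFact_ne {q : ℂ} (h : Generic q) (n : ℕ) : qFact q n ≠ 0 :=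
  Finset.prod_ne_zero_iff.2 fun _ _ => h.qInt_ne (Nat.succ_pos _)

theorem qBinom_zero {q : ℂ} (h : Generic q) (n : ℕ) : qBinom q n 0 = 1 := by
  have := h.qFact_ne n
  simp only [qBinom, Nat.sub_zero]
  rw [show qFact q 0 = 1 by simp [qFact], one_mul, div_self this]

theorem qBinom_self {q : ℂ} (h : Generic q) (n : ℕ) : qBinom q n n = 1 := by
  have := qBinom_symm q (Nat.zero_le n)
  rwa [Nat.sub_zero, qBinom_zero h] at this

/-- The `q`-Pascal rule. -/
theorem qBinom_pascal {q : ℂ} (h : Generic q) {m k : ℕ} (hk : k + 1 ≤ m) :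
    qBinom q (m + 1) (k + 1) =
      (q⁻¹) ^ (k + 1) * qBinom q m (k + 1) + q ^ (m - k) * qBinom q m k := by
  obtain ⟨l, rfl⟩ := Nat.exists_eq_add_of_le hk
  have e1 : k + 1 + l + 1 - (k + 1) = l + 1 := by omega
  have e2 : k + 1 + l - (k + 1) = l := by omega
  have e3 : k + 1 + l - k = l + 1 := by omega
  simp only [qBinom, e1, e2, e3]
  rw [qFact_succ q (k + 1 + l), qFact_succ q k, qFact_succ q l]
  have h1 := h.qFact_ne k
  have h2 := h.qFact_ne l
  have h3 := h.qInt_ne (Nat.succ_pos k)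
  have h4 := h.qInt_ne (Nat.succ_pos l)
  have key : qInt q (k + 1 + l + 1) =
      (q⁻¹) ^ (k + 1) * qInt q (l + 1) + q ^ (l + 1) * qInt q (k + 1) := by
    have h5 := h.sub_ne
    have h6 := h.1
    have h7 : q ^ 2 - 1 ≠ 0 := sub_ne_zero.2 (h.2 2 (by norm_num))
    unfold qInt
    rw [mul_div_assoc', mul_div_assoc', ← add_div]
    congr 1
    rw [inv_pow]
    field_simp
    ring
  rw [key]
  field_simp

/-- The Serre expression with an additional scaling parameter. -/
def serreT (q : ℂ) (m : ℕ) (t : ℂ) (e x : R) : R :=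
  ∑ k ∈ Finset.range (m + 1), ((-1) ^ k * qBinom q m k * t ^ k) • (e ^ (m - k) * x * e ^ k)

theorem serreT_succ {q : ℂ} (h : Generic q) (m : ℕ) (t : ℂ) (e x : R) :
    serreT q (m + 1) t e x =
      e * serreT q m (t * q⁻¹) e x - (t * q ^ m) • (serreT q m (t * q⁻¹) e x * e) := by
  unfold serreT
  rw [Finset.mul_sum, Finset.sum_mul, Finset.smul_sum]
  rw [Finset.sum_range_succ', Finset.sum_range_succ,
    Finset.sum_range_succ' (fun k => e * _), Finset.sum_range_succ (fun k => (t * q ^ m) • _)]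
  have hmid : ∀ k ∈ Finset.range m,
      ((-1) ^ (k + 1) * qBinom q (m + 1) (k + 1) * t ^ (k + 1)) •
        (e ^ (m + 1 - (k + 1)) * x * e ^ (k + 1)) =
      e * (((-1) ^ (k + 1) * qBinom q m (k + 1) * (t * q⁻¹) ^ (k + 1)) •
        (e ^ (m - (k + 1)) * x * e ^ (k + 1))) -
      (t * q ^ m) • (((-1) ^ k * qBinom q m k * (t * q⁻¹) ^ k) •
        (e ^ (m - k) * x * e ^ k) * e) := by
    intro k hk
    have hk' : k + 1 ≤ m := Finset.mem_range.1 hk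
    rw [qBinom_pascal h hk', mul_smul_comm, smul_mul_assoc, smul_smul]
    have a1 : e * (e ^ (m - (k + 1)) * x * e ^ (k + 1)) = e ^ (m - k) * x * e ^ (k + 1) := by
      rw [← mul_assoc, ← mul_assoc, ← pow_succ']
      congr 4
      omega
    have a2 : e ^ (m - k) * x * e ^ k * e = e ^ (m - k) * x * e ^ (k + 1) := by
      rw [mul_assoc, ← pow_succ]
    have a3 : m + 1 - (k + 1) = m - k := by omega
    rw [a1, a2, a3, ← sub_smul]
    congr 1
    have hq := h.1
    have a4 : q ^ m = q ^ (m - k) * q ^ k := by rw [← pow_add]; congr 1; omega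
    rw [a4, mul_pow, mul_pow]
    have a5 : q ^ k * q⁻¹ ^ k = 1 := by rw [← mul_pow, mul_inv_cancel₀ hq, one_pow]
    rw [pow_succ (-1 : ℂ) k, pow_succ t k]
    linear_combination ((-1 : ℂ) ^ k * t * t ^ k * q ^ (m - k) * qBinom q m k) * a5
  rw [Finset.sum_congr rfl hmid, Finset.sum_sub_distrib]
  have hlast : ((-1) ^ (m + 1) * qBinom q (m + 1) (m + 1) * t ^ (m + 1)) •
        (e ^ (m + 1 - (m + 1)) * x * e ^ (m + 1)) =
      -((t * q ^ m) • (((-1) ^ m * qBinom q m m * (t * q⁻¹) ^ m) •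
        (e ^ (m - m) * x * e ^ m) * e)) := by
    rw [qBinom_self h, qBinom_self h, smul_mul_assoc, smul_smul, ← neg_smul, Nat.sub_self,
      Nat.sub_self, mul_assoc, mul_assoc (e ^ 0 * x), ← pow_succ, ← mul_assoc]
    congr 1
    have a5 : q ^ m * q⁻¹ ^ m = 1 := by rw [← mul_pow, mul_inv_cancel₀ h.1, one_pow]
    rw [mul_pow]
    linear_combination (t * (-1) ^ m * t ^ m) * a5
  have hfirst : ((-1) ^ 0 * qBinom q (m + 1) 0 * t ^ 0) • (e ^ (m + 1 - 0) * x * e ^ 0) =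
      e * (((-1) ^ 0 * qBinom q m 0 * (t * q⁻¹) ^ 0) • (e ^ (m - 0) * x * e ^ 0)) := by
    simp [qBinom_zero h, pow_succ', mul_assoc]
  rw [hlast, hfirst]
  abel

/-- Iterated `q`-commutators: `w₀ = x`, `wᵣ₊₁ = e wᵣ - u vʳ wᵣ e`. -/
def qComm (u v : ℂ) (e x : R) : ℕ → R
  | 0 => x
  | r + 1 => e * qComm u v e x r - (u * v ^ r) • (qComm u v e x r * e)

theorem serreT_eq_qComm {q : ℂ} (h : Generic q) (e x : R) (m : ℕ) :
    ∀ t u : ℂ, u * q ^ m = t * q → serreT q m t e x = qComm u (q ^ 2) e x m := by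
  induction m with
  | zero => intro t u _; simp [serreT, qComm, qBinom_zero h]
  | succ m ih =>
    intro t u hu
    have hq := h.1
    have hu' : u * q ^ m = t := mul_right_cancel₀ hq (by rw [mul_assoc, ← pow_succ, hu])
    rw [serreT_succ h, ih (t * q⁻¹) u (by rw [inv_mul_cancel_right₀ hq, hu']), qComm]
    congr 2
    rw [← hu', ← pow_mul]
    ring

theorem serre_eq_qComm {q : ℂ} (h : Generic q) (e x : R) (m : ℕ) (u : ℂ) (hu : u * q ^ m = q) :
    serre q m e x = qComm u (q ^ 2) e x m := by
  rw [← serreT_eq_qComm h e x m 1 u (by rw [one_mul, hu])]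
  simp [serre, serreT]

theorem qComm_add (u v : ℂ) (a b x : R) (hx : b * x = u • (x * b)) (ha : b * a = v • (a * b))
    (m : ℕ) : qComm u v (a + b) x m = qComm u v a x m ∧
      b * qComm u v a x m = (u * v ^ m) • (qComm u v a x m * b) := by
  induction m with
  | zero => simpa [qComm] using hx
  | succ m ih =>
    obtain ⟨h1, h2⟩ := ih
    constructor
    · rw [qComm, qComm, h1, add_mul, mul_add, h2, smul_add]
      abel
    · rw [qComm, mul_sub, sub_mul, mul_smul_comm, ← mul_assoc, ha, smul_mul_assoc, mul_assoc, h2,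
        ← mul_assoc, h2, smul_mul_assoc, smul_mul_assoc, mul_assoc, ha]
      simp only [mul_smul_comm, smul_smul, smul_sub, mul_assoc]
      congr 2 <;> ring

/-- If `b` `q`-commutes past `x` and `a` with the right constants, then `b` drops out. -/
theorem serre_add {q : ℂ} (h : Generic q) (m : ℕ) (u : ℂ) (a b x : R)
    (hu : u * q ^ m = q) (hx : b * x = u • (x * b)) (ha : b * a = (q ^ 2) • (a * b)) :
    serre q m (a + b) x = serre q m a x := by
  rw [serre_eq_qComm h _ _ _ u hu, serre_eq_qComm h _ _ _ u hu]
  exact (qComm_add u _ a b x hx ha m).1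

theorem qComm_mul (u v α γ : ℂ) (p k x l : R) (hkl : l * k = k * l)
    (hkp : k * p = α • (p * k)) (hkx : k * x = γ • (x * k)) (hlp : l * p = γ • (p * l)) (m : ℕ) :
    k * qComm u v p x m = (γ * α ^ m) • (qComm u v p x m * k) ∧
    k ^ m * l * p = (γ * α ^ m) • (p * (k ^ m * l)) ∧
    ∃ c : ℂ, qComm u v (p * k) (x * l) m = c • (qComm u v p x m * (k ^ m * l)) := by
  induction m with
  | zero =>
    refine ⟨by simpa [qComm] using hkx, by simpa using hlp, 1, by simp [qComm]⟩
  | succ m ih =>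
    obtain ⟨h1, h2, c, h3⟩ := ih
    refine ⟨?_, ?_, c * (γ * α ^ m), ?_⟩
    · rw [qComm, mul_sub, sub_mul, mul_smul_comm, ← mul_assoc, hkp, smul_mul_assoc, mul_assoc, h1,
        ← mul_assoc, h1, smul_mul_assoc, smul_mul_assoc, mul_assoc, hkp]
      simp only [mul_smul_comm, smul_smul, smul_sub, mul_assoc]
      congr 2 <;> ring
    · rw [pow_succ', mul_assoc, mul_assoc, ← mul_assoc _ l, h2, mul_smul_comm, ← mul_assoc, hkp,
        smul_mul_assoc, smul_smul, pow_succ α]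
      simp only [mul_assoc]
    · have e1 : p * k * (qComm u v p x m * (k ^ m * l)) =
          (γ * α ^ m) • (p * qComm u v p x m * (k ^ (m + 1) * l)) := by
        rw [mul_assoc, ← mul_assoc k, h1, pow_succ']
        simp only [smul_mul_assoc, mul_smul_comm, mul_assoc]
      have e2 : qComm u v p x m * (k ^ m * l) * (p * k) =
          (γ * α ^ m) • (qComm u v p x m * p * (k ^ (m + 1) * l)) := by
        rw [mul_assoc, ← mul_assoc _ p, h2, smul_mul_assoc, mul_smul_comm, mul_assoc, mul_assoc,
          hkl, ← mul_assoc (k ^ m), ← pow_succ, mul_assoc]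
      rw [qComm, h3, mul_smul_comm, smul_mul_assoc, e1, e2, qComm, sub_mul, smul_mul_assoc,
        smul_sub]
      simp only [smul_smul]
      congr 2
      ring

theorem serre_mul_eq_zero {q : ℂ} (h : Generic q) (m : ℕ) (α γ : ℂ) (p k x l : R)
    (hkl : l * k = k * l) (hkp : k * p = α • (p * k)) (hkx : k * x = γ • (x * k))
    (hlp : l * p = γ • (p * l)) (h0 : serre q m p x = 0) : serre q m (p * k) (x * l) = 0 := by
  have hu : (q * (q ^ m)⁻¹) * q ^ m = q := inv_mul_cancel_right₀ (pow_ne_zero _ h.1) _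
  rw [serre_eq_qComm h _ _ _ _ hu] at h0 ⊢
  obtain ⟨c, hc⟩ := (qComm_mul (q * (q ^ m)⁻¹) (q ^ 2) α γ p k x l hkl hkp hkx hlp m).2.2
  rw [hc, h0, zero_mul, smul_zero]

theorem serre_smul (q : ℂ) (m : ℕ) (c d : ℂ) (e x : R) :
    serre q m (c • e) (d • x) = (c ^ m * d) • serre q m e x := by
  unfold serre
  rw [Finset.smul_sum]
  refine Finset.sum_congr rfl fun k hk => ?_
  have hk' : k ≤ m := Nat.lt_succ_iff.1 (Finset.mem_range.1 hk)
  simp only [smul_pow, smul_mul_assoc, mul_smul_comm, smul_smul]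
  congr 1
  have : c ^ m = c ^ (m - k) * c ^ k := by rw [← pow_add, Nat.sub_add_cancel hk']
  rw [this]
  ring

theorem serre_op (q : ℂ) (m : ℕ) (e x : R) :
    serre q m (MulOpposite.op e) (MulOpposite.op x) =
      (-1 : ℂ) ^ m • MulOpposite.op (serre q m e x) := by
  unfold serre
  rw [← Finset.sum_range_reflect, ← MulOpposite.op_smul, Finset.smul_sum, Finset.op_sum]
  refine Finset.sum_congr rfl fun k hk => ?_
  have hk' : k ≤ m := Nat.lt_succ_iff.1 (Finset.mem_range.1 hk)
  have e1 : m + 1 - 1 - k = m - k := by omega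
  rw [e1, qBinom_symm q hk', Nat.sub_sub_self hk', smul_smul, MulOpposite.op_smul,
    MulOpposite.op_mul, MulOpposite.op_mul, MulOpposite.op_pow, MulOpposite.op_pow, mul_assoc]
  congr 1
  have : (-1 : ℂ) ^ m = (-1) ^ (m - k) * (-1) ^ k := by rw [← pow_add, Nat.sub_add_cancel hk']
  have h2 : (-1 : ℂ) ^ k * (-1) ^ k = 1 := by rw [← mul_pow]; simp
  rw [this]
  linear_combination (-(-1 : ℂ) ^ (m - k) * qBinom q m k) * h2

theorem map_serre {R' : Type*} [Ring R'] [Algebra ℂ R'] (f : R →ₐ[ℂ] R') (q : ℂ) (m : ℕ)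
    (e x : R) : f (serre q m e x) = serre q m (f e) (f x) := by
  simp [serre, map_sum]

end SerreLemmas

theorem serre_add_right {R : Type*} [Ring R] [Algebra ℂ R] (q : ℂ) (m : ℕ) (e x y : R) :
    serre q m e (x + y) = serre q m e x + serre q m e y := by
  simp [serre, mul_add, add_mul, Finset.sum_add_distrib]

theorem serre_coprod {R : Type*} [Ring R] [Algebra ℂ R] {q : ℂ} (h : Generic q) (m : ℕ) (u : ℂ)
    (hu : u * q ^ m = q) (a b x y : R) (hx : x * b = u • (b * x)) (hy : a * y = u • (y * a))
    (hab : a * b = (q ^ 2) • (b * a)) (h1 : serre q m a x = 0) (h2 : serre q m b y = 0) :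
    serre q m (a + b) (x + y) = 0 := by
  have hq := h.1
  have hu0 : u ≠ 0 := by
    rintro rfl
    rw [zero_mul] at hu
    exact hq hu.symm
  have e1 : serre q m (a + b) x = serre q m a x := by
    rw [← serre_inv, ← serre_inv q m a]
    refine serre_add h.inv m u⁻¹ a b x ?_ ?_ ?_
    · rw [inv_pow, ← mul_inv, hu]
    · rw [hx, smul_smul, inv_mul_cancel₀ hu0, one_smul]
    · rw [hab, smul_smul, inv_pow, inv_mul_cancel₀ (pow_ne_zero _ hq), one_smul]
  have e2 : serre q m (a + b) y = serre q m b y := by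
    rw [add_comm a b]
    exact serre_add h m u b a y hu hy hab
  rw [serre_add_right, e1, e2, h1, h2, add_zero]

/-! ### Cartan data and quantized enveloping algebras -/

/-- The numerical data entering the definition of `U_q(𝔤)`: a generalized Cartan matrix `(a_ij)`,
numbers `d_i > 0` with `d_i a_ij = d_j a_ji`, and a real number `q > 0`, `q ≠ 1`. -/
structure Datum (ι : Type*) where
  a : ι → ι → ℤ
  d : ι → ℝ
  q : ℝ
  a_diag : ∀ i, a i i = 2
  a_nonpos : ∀ i j, i ≠ j → a i j ≤ 0
  d_pos : ∀ i, 0 < d i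
  symm : ∀ i j, d i * a i j = d j * a j i
  q_pos : 0 < q
  q_ne_one : q ≠ 1

namespace Datum

variable {ι : Type*} (D : Datum ι)

/-- `q_i = q ^ d_i`. -/
def qi (i : ι) : ℂ := ((D.q ^ D.d i : ℝ) : ℂ)

theorem qi_real_pos (i : ι) : 0 < D.q ^ D.d i := Real.rpow_pos_of_pos D.q_pos _

theorem qi_ne_zero (i : ι) : D.qi i ≠ 0 := Complex.ofReal_ne_zero.2 (D.qi_real_pos i).ne'

theorem qi_generic (i : ι) : Generic (D.qi i) := by
  refine ⟨D.qi_ne_zero i, fun n hn h => ?_⟩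
  rw [qi, ← Complex.ofReal_pow, Complex.ofReal_eq_one, pow_eq_one_iff_of_nonneg
    (D.qi_real_pos i).le hn.ne'] at h
  have h2 := congrArg Real.log h
  rw [Real.log_rpow D.q_pos, Real.log_one] at h2
  exact (mul_ne_zero (D.d_pos i).ne' (Real.log_ne_zero_of_pos_of_ne_one D.q_pos D.q_ne_one)) h2

theorem conj_qi (i : ι) : (starRingEnd ℂ) (D.qi i) = D.qi i := Complex.conj_ofReal _

theorem qi_symm (i j : ι) : D.qi i ^ D.a i j = D.qi j ^ D.a j i := by
  rw [qi, qi, ← Complex.ofReal_zpow, ← Complex.ofReal_zpow, ← Real.rpow_intCast,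
    ← Real.rpow_intCast, ← Real.rpow_mul D.q_pos.le, ← Real.rpow_mul D.q_pos.le, D.symm]

/-- The degree `1 - a_ij` of the Serre relation (only used for `i ≠ j`, where it is positive). -/
def serreDeg (i j : ι) : ℕ := (1 - D.a i j).toNat

theorem qi_serreDeg {i j : ι} (h : i ≠ j) : D.qi i ^ D.a i j * D.qi i ^ D.serreDeg i j = D.qi i := by
  have h1 := D.a_nonpos i j h
  rw [← zpow_natCast, ← zpow_add₀ (D.qi_ne_zero i), serreDeg, Int.toNat_of_nonneg (by omega)]
  simp

open scoped Classical in
/-- A family of elements of an algebra satisfying the defining relations of `U_q(𝔤)`. -/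
structure Relations {R : Type*} [Ring R] [Algebra ℂ R] (e f k k' : ι → R) :
    Prop where
  kk' : ∀ i, k i * k' i = 1
  k'k : ∀ i, k' i * k i = 1
  comm : ∀ i j, k i * k j = k j * k i
  ke : ∀ i j, k i * e j * k' i = (D.qi i ^ D.a i j) • e j
  kf : ∀ i j, k i * f j * k' i = (D.qi i ^ (-D.a i j)) • f j
  ef : ∀ i j, e i * f j - f j * e i =
    if i = j then (D.qi i - (D.qi i)⁻¹)⁻¹ • (k i - k' i) else 0
  serreE : ∀ i j, i ≠ j → serre (D.qi i) (D.serreDeg i j) (e i) (e j) = 0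
  serreF : ∀ i j, i ≠ j → serre (D.qi i) (D.serreDeg i j) (f i) (f j) = 0

/-- The generators of `U_q(𝔤)`; `K'` stands for the inverse of `K`. -/
inductive Gen (ι : Type*)
  | E : ι → Gen ι
  | F : ι → Gen ι
  | K : ι → Gen ι
  | K' : ι → Gen ι

/-- The free generators. -/
abbrev fE (i : ι) : FreeAlgebra ℂ (Gen ι) := FreeAlgebra.ι ℂ (Gen.E i)

/-- The free generators. -/
abbrev fF (i : ι) : FreeAlgebra ℂ (Gen ι) := FreeAlgebra.ι ℂ (Gen.F i)

/-- The free generators. -/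
abbrev fK (i : ι) : FreeAlgebra ℂ (Gen ι) := FreeAlgebra.ι ℂ (Gen.K i)

/-- The free generators. -/
abbrev fK' (i : ι) : FreeAlgebra ℂ (Gen ι) := FreeAlgebra.ι ℂ (Gen.K' i)

open scoped Classical in
/-- The defining relations of `U_q(𝔤)` in the free algebra on the generators. -/
inductive Rel : FreeAlgebra ℂ (Gen ι) → FreeAlgebra ℂ (Gen ι) → Prop
  | kk' (i : ι) : Rel (fK i * fK' i) 1
  | k'k (i : ι) : Rel (fK' i * fK i) 1
  | comm (i j : ι) : Rel (fK i * fK j) (fK j * fK i)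
  | ke (i j : ι) : Rel (fK i * fE j * fK' i) ((D.qi i ^ D.a i j) • fE j)
  | kf (i j : ι) : Rel (fK i * fF j * fK' i) ((D.qi i ^ (-D.a i j)) • fF j)
  | ef (i j : ι) : Rel (fE i * fF j - fF j * fE i)
      (if i = j then (D.qi i - (D.qi i)⁻¹)⁻¹ • (fK i - fK' i) else 0)
  | serreE (i j : ι) (h : i ≠ j) : Rel (serre (D.qi i) (D.serreDeg i j) (fE i) (fE j)) 0
  | serreF (i j : ι) (h : i ≠ j) : Rel (serre (D.qi i) (D.serreDeg i j) (fF i) (fF j)) 0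

/-- The quantized enveloping algebra `U_q(𝔤)`. -/
def Uq : Type _ := RingQuot D.Rel

instance : Ring D.Uq := inferInstanceAs (Ring (RingQuot D.Rel))

instance : Algebra ℂ D.Uq := inferInstanceAs (Algebra ℂ (RingQuot D.Rel))

/-- The quotient map from the free algebra. -/
def toUq : FreeAlgebra ℂ (Gen ι) →ₐ[ℂ] D.Uq := RingQuot.mkAlgHom ℂ D.Rel

/-- The generator `E_i`. -/
def E (i : ι) : D.Uq := D.toUq (FreeAlgebra.ι ℂ (Gen.E i))

/-- The generator `F_i`. -/
def F (i : ι) : D.Uq := D.toUq (FreeAlgebra.ι ℂ (Gen.F i))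

/-- The generator `K_i`. -/
def K (i : ι) : D.Uq := D.toUq (FreeAlgebra.ι ℂ (Gen.K i))

/-- The generator `K_i⁻¹`. -/
def K' (i : ι) : D.Uq := D.toUq (FreeAlgebra.ι ℂ (Gen.K' i))

theorem toUq_rel {x y : FreeAlgebra ℂ (Gen ι)} (h : D.Rel x y) : D.toUq x = D.toUq y :=
  RingQuot.mkAlgHom_rel ℂ h

theorem relations : D.Relations D.E D.F D.K D.K' where
  kk' i := by simpa [K, K'] using D.toUq_rel (.kk' i)
  k'k i := by simpa [K, K'] using D.toUq_rel (.k'k i)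
  comm i j := by simpa [K] using D.toUq_rel (.comm i j)
  ke i j := by simpa [K, K', E] using D.toUq_rel (.ke i j)
  kf i j := by simpa only [map_mul, map_smul, E, F, K, K'] using D.toUq_rel (.kf i j)
  ef i j := by
    have := D.toUq_rel (.ef i j)
    split_ifs at this ⊢ with h
    · simpa [K, K', E, F] using this
    · simpa [K, K', E, F] using this
  serreE i j h := by simpa [map_serre, E] using D.toUq_rel (.serreE i j h)
  serreF i j h := by simpa [map_serre, F] using D.toUq_rel (.serreF i j h)

variable {D}

/-- The universal property of `U_q(𝔤)`. -/
def lift {R : Type*} [Ring R] [Algebra ℂ R] {e f k k' : ι → R} (h : D.Relations e f k k') :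
    D.Uq →ₐ[ℂ] R :=
  RingQuot.liftAlgHom ℂ ⟨FreeAlgebra.lift ℂ (fun g => match g with
    | .E i => e i
    | .F i => f i
    | .K i => k i
    | .K' i => k' i), by
      intro x y hxy
      cases hxy with
      | kk' i => simpa using h.kk' i
      | k'k i => simpa using h.k'k i
      | comm i j => simpa using h.comm i j
      | ke i j => simpa using h.ke i j
      | kf i j => simpa only [map_mul, map_smul, FreeAlgebra.lift_ι_apply] using h.kf i j
      | ef i j =>
        have := h.ef i j
        split_ifs at this ⊢ with h
        · simpa using this
        · simpa using this
      | serreE i j hij => simpa [map_serre] using h.serreE i j hij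
      | serreF i j hij => simpa [map_serre] using h.serreF i j hij⟩

section lift

variable {R : Type*} [Ring R] [Algebra ℂ R] {e f k k' : ι → R} (h : D.Relations e f k k')

@[simp] theorem lift_E (i : ι) : lift h (D.E i) = e i := by
  exact (RingQuot.liftAlgHom_mkAlgHom_apply ℂ _ _ _).trans (by simp)

@[simp] theorem lift_F (i : ι) : lift h (D.F i) = f i := by
  exact (RingQuot.liftAlgHom_mkAlgHom_apply ℂ _ _ _).trans (by simp)

@[simp] theorem lift_K (i : ι) : lift h (D.K i) = k i := by
  exact (RingQuot.liftAlgHom_mkAlgHom_apply ℂ _ _ _).trans (by simp)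

@[simp] theorem lift_K' (i : ι) : lift h (D.K' i) = k' i := by
  exact (RingQuot.liftAlgHom_mkAlgHom_apply ℂ _ _ _).trans (by simp)

end lift

/-- Algebra maps out of `U_q(𝔤)` are determined by the generators. -/
theorem algHom_ext {R : Type*} [Semiring R] [Algebra ℂ R] {φ ψ : D.Uq →ₐ[ℂ] R}
    (hE : ∀ i, φ (D.E i) = ψ (D.E i)) (hF : ∀ i, φ (D.F i) = ψ (D.F i))
    (hK : ∀ i, φ (D.K i) = ψ (D.K i)) (hK' : ∀ i, φ (D.K' i) = ψ (D.K' i)) : φ = ψ := by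
  have : φ.comp D.toUq = ψ.comp D.toUq := by
    ext g
    cases g with
    | E i => exact hE i
    | F i => exact hF i
    | K i => exact hK i
    | K' i => exact hK' i
  exact RingQuot.ringQuot_ext' ℂ φ ψ this

/-- `U_q(𝔤)` is generated by `E_i`, `F_i`, `K_i`, `K_i⁻¹`. -/
theorem induction_gen {p : D.Uq → Prop} (h1 : p 1) (hE : ∀ i x, p x → p (D.E i * x))
    (hF : ∀ i x, p x → p (D.F i * x)) (hK : ∀ i x, p x → p (D.K i * x))
    (hK' : ∀ i x, p x → p (D.K' i * x)) (hadd : ∀ x y, p x → p y → p (x + y))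
    (hsmul : ∀ (c : ℂ) x, p x → p (c • x)) (x : D.Uq) : p x := by
  obtain ⟨y, rfl⟩ := RingQuot.mkAlgHom_surjective ℂ D.Rel x
  change p (D.toUq y)
  suffices h : ∀ z, p z → p (D.toUq y * z) by simpa using h 1 h1
  induction y using FreeAlgebra.induction with
  | grade0 c =>
    intro z hz
    rw [AlgHom.commutes, ← Algebra.smul_def]
    exact hsmul c z hz
  | grade1 g =>
    intro z hz
    cases g with
    | E i => exact hE i z hz
    | F i => exact hF i z hz
    | K i => exact hK i z hz
    | K' i => exact hK' i z hz
  | mul a b ha hb =>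
    intro z hz
    rw [map_mul, mul_assoc]
    exact ha _ (hb _ hz)
  | add a b ha hb =>
    intro z hz
    rw [map_add, add_mul]
    exact hadd _ _ (ha _ hz) (hb _ hz)

/-! ### Consequences of the relations -/

section

variable {R : Type*} [Ring R] [Algebra ℂ R]

theorem conj_to_comm {x y y' z : R} {c : ℂ} (h : y' * y = 1) (hz : y * x * y' = c • z) :
    y * x = c • (z * y) := by
  rw [← smul_mul_assoc, ← hz, mul_assoc _ y', h, mul_one]

theorem comm_inv {x y y' : R} {c : ℂ} (hc : c ≠ 0) (h : y' * y = 1) (h' : y * y' = 1)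
    (hz : y * x = c • (x * y)) : y' * x = c⁻¹ • (x * y') := by
  have : x * y' = c • (y' * x) := by
    calc x * y' = y' * (y * x) * y' := by rw [← mul_assoc y', h, one_mul]
      _ = c • (y' * x) := by
        rw [hz, mul_smul_comm, smul_mul_assoc, mul_assoc, mul_assoc, h', mul_one]
  rw [this, smul_smul, inv_mul_cancel₀ hc, one_smul]

end

section Relations

variable {R : Type*} [Ring R] [Algebra ℂ R] {e f k k' : ι → R}

namespace Relations

theorem k_e (h : D.Relations e f k k') (i j : ι) :
    k i * e j = (D.qi i ^ D.a i j) • (e j * k i) := conj_to_comm (h.k'k i) (h.ke i j)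

theorem k_f (h : D.Relations e f k k') (i j : ι) :
    k i * f j = (D.qi i ^ (-D.a i j)) • (f j * k i) := conj_to_comm (h.k'k i) (h.kf i j)

theorem k'_e (h : D.Relations e f k k') (i j : ι) :
    k' i * e j = (D.qi i ^ (-D.a i j)) • (e j * k' i) := by
  rw [zpow_neg]
  exact comm_inv (zpow_ne_zero _ (D.qi_ne_zero i)) (h.k'k i) (h.kk' i) (h.k_e i j)

theorem k'_f (h : D.Relations e f k k') (i j : ι) :
    k' i * f j = (D.qi i ^ D.a i j) • (f j * k' i) := by
  have := comm_inv (zpow_ne_zero _ (D.qi_ne_zero i)) (h.k'k i) (h.kk' i) (h.k_f i j)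
  rwa [← zpow_neg, neg_neg] at this

theorem k'_k (h : D.Relations e f k k') (i j : ι) : k' i * k j = k j * k' i := by
  have := comm_inv one_ne_zero (h.k'k i) (h.kk' i)
    (show k i * k j = (1 : ℂ) • (k j * k i) by rw [one_smul, h.comm])
  rwa [inv_one, one_smul] at this

theorem k'_k' (h : D.Relations e f k k') (i j : ι) : k' i * k' j = k' j * k' i := by
  have := comm_inv one_ne_zero (h.k'k i) (h.kk' i)
    (show k i * k' j = (1 : ℂ) • (k' j * k i) by rw [one_smul, h.k'_k])
  rwa [inv_one, one_smul] at this

theorem twE (h : D.Relations e f k k') {i j : ι} (hij : i ≠ j) :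
    serre (D.qi i) (D.serreDeg i j) (e i * k' i) (e j * k' j) = 0 := by
  refine serre_mul_eq_zero (D.qi_generic i) _ _ _ _ _ _ _ (h.k'_k' j i) (h.k'_e i i) (h.k'_e i j)
    ?_ (h.serreE i j hij)
  rw [h.k'_e j i, zpow_neg, zpow_neg, D.qi_symm]

theorem twF (h : D.Relations e f k k') {i j : ι} (hij : i ≠ j) :
    serre (D.qi i) (D.serreDeg i j) (f i * k i) (f j * k j) = 0 := by
  refine serre_mul_eq_zero (D.qi_generic i) _ _ _ _ _ _ _ (h.comm j i) (h.k_f i i) (h.k_f i j)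
    ?_ (h.serreF i j hij)
  rw [h.k_f j i, zpow_neg, zpow_neg, D.qi_symm]

open scoped Classical in
theorem ef_tw (h : D.Relations e f k k') (i j : ι) :
    e i * k' i * (k j * f j) - k j * f j * (e i * k' i) =
      if i = j then (D.qi i - (D.qi i)⁻¹)⁻¹ • (k i - k' i) else 0 := by
  have h1 : e i * k' i * (k j * f j) = k j * (e i * f j) * k' i := by
    have hc := zpow_ne_zero (D.a i j) (D.qi_ne_zero i)
    calc e i * k' i * (k j * f j) = e i * k j * (k' i * f j) := by
          rw [mul_assoc, ← mul_assoc (k' i), h.k'_k]; simp only [mul_assoc]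
      _ = (D.qi i ^ D.a i j) • (e i * k j) * (f j * k' i) := by
          rw [h.k'_f, mul_smul_comm, smul_mul_assoc]
      _ = k j * (e i * f j) * k' i := by
          rw [D.qi_symm, ← h.k_e]; simp only [mul_assoc]
  have h2 : k j * f j * (e i * k' i) = k j * (f j * e i) * k' i := by simp only [mul_assoc]
  rw [h1, h2, ← sub_mul, ← mul_sub, h.ef]
  split_ifs with hij
  · subst hij
    rw [mul_smul_comm, smul_mul_assoc, mul_sub, sub_mul, h.kk', one_mul, mul_assoc, h.kk', mul_one]
  · simp

open scoped Classical in
theorem ef_tw' (h : D.Relations e f k k') (i j : ι) :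
    f j * k j * (k' i * e i) - k' i * e i * (f j * k j) =
      if i = j then (D.qi i - (D.qi i)⁻¹)⁻¹ • (k' i - k i) else 0 := by
  have h1 : f j * k j * (k' i * e i) = k' i * (f j * e i) * k j := by
    calc f j * k j * (k' i * e i) = f j * k' i * (k j * e i) := by
          rw [mul_assoc, ← mul_assoc (k j), ← h.k'_k]; simp only [mul_assoc]
      _ = (D.qi i ^ D.a i j) • (f j * k' i) * (e i * k j) := by
          rw [h.k_e, mul_smul_comm, smul_mul_assoc, D.qi_symm]
      _ = k' i * (f j * e i) * k j := by
          rw [← h.k'_f]; simp only [mul_assoc]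
  have h2 : k' i * e i * (f j * k j) = k' i * (e i * f j) * k j := by simp only [mul_assoc]
  rw [h1, h2, ← sub_mul, ← mul_sub, ← neg_sub (e i * f j), h.ef]
  split_ifs with hij
  · subst hij
    rw [mul_neg, neg_mul, mul_smul_comm, smul_mul_assoc, mul_sub, sub_mul, h.k'k, one_mul,
      mul_assoc, h.k'k, mul_one, ← smul_neg, neg_sub]
  · simp

end Relations

end Relations

/-! ### The Hopf algebra structure -/

open scoped Classical in
theorem comul_relations : D.Relations (R := D.Uq ⊗[ℂ] D.Uq)
    (fun i => D.E i ⊗ₜ D.K i + 1 ⊗ₜ D.E i) (fun i => D.F i ⊗ₜ 1 + D.K' i ⊗ₜ D.F i)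
    (fun i => D.K i ⊗ₜ D.K i) (fun i => D.K' i ⊗ₜ D.K' i) := by
  have h := D.relations
  have tsE (i j : ι) (hij : i ≠ j) (k : D.Uq →ₐ[ℂ] D.Uq ⊗[ℂ] D.Uq) :
      serre (D.qi i) (D.serreDeg i j) (k (D.E i)) (k (D.E j)) = 0 := by
    rw [← map_serre, h.serreE i j hij, map_zero]
  have tsF (i j : ι) (hij : i ≠ j) (k : D.Uq →ₐ[ℂ] D.Uq ⊗[ℂ] D.Uq) :
      serre (D.qi i) (D.serreDeg i j) (k (D.F i)) (k (D.F j)) = 0 := by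
    rw [← map_serre, h.serreF i j hij, map_zero]
  have pow2 (i : ι) : D.qi i ^ D.a i i = D.qi i ^ 2 := by rw [D.a_diag]; norm_cast
  refine ⟨fun i => ?_, fun i => ?_, fun i j => ?_, fun i j => ?_, fun i j => ?_, fun i j => ?_,
    fun i j hij => ?_, fun i j hij => ?_⟩
  · simp [h.kk', Algebra.TensorProduct.one_def]
  · simp [h.k'k, Algebra.TensorProduct.one_def]
  · simp [h.comm i j]
  · simp only [mul_add, add_mul, Algebra.TensorProduct.tmul_mul_tmul, mul_one, h.ke, h.kk', smul_add,
      h.comm i j, TensorProduct.smul_tmul', TensorProduct.tmul_smul]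
    rw [mul_assoc, h.kk', mul_one]
  · simp only [mul_add, add_mul, Algebra.TensorProduct.tmul_mul_tmul, mul_one, h.kf, h.kk', smul_add,
      ← h.k'_k j i, TensorProduct.smul_tmul', TensorProduct.tmul_smul]
    rw [mul_assoc, h.kk', mul_one]
  · simp only [mul_add, add_mul, Algebra.TensorProduct.tmul_mul_tmul, mul_one, one_mul]
    have e1 : (D.K' j * D.E i) ⊗ₜ[ℂ] (D.F j * D.K i) = (D.E i * D.K' j) ⊗ₜ[ℂ] (D.K i * D.F j) := by
      rw [h.k'_e, h.k_f, TensorProduct.tmul_smul, TensorProduct.smul_tmul', zpow_neg, zpow_neg,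
        D.qi_symm]
    have e3 : (D.E i * D.F j - D.F j * D.E i) ⊗ₜ[ℂ] D.K i +
        D.K' j ⊗ₜ[ℂ] (D.E i * D.F j - D.F j * D.E i) =
        if i = j then (D.qi i - (D.qi i)⁻¹)⁻¹ • (D.K i ⊗ₜ[ℂ] D.K i - D.K' i ⊗ₜ[ℂ] D.K' i) else 0 := by
      rw [h.ef]
      split_ifs with hij
      · subst hij
        rw [← TensorProduct.smul_tmul', TensorProduct.tmul_smul, TensorProduct.sub_tmul,
          TensorProduct.tmul_sub, ← smul_add]
        congr 1
        abel
      · simp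
    rw [← e3, TensorProduct.sub_tmul, TensorProduct.tmul_sub]
    rw [e1]
    abel
  · have hz := D.qi_serreDeg hij
    refine serre_coprod (D.qi_generic i) _ _ hz _ _ _ _ ?_ ?_ ?_ ?_ ?_
    · simp only [Algebra.TensorProduct.tmul_mul_tmul, mul_one, one_mul]
      rw [h.k_e j i, TensorProduct.tmul_smul, D.qi_symm]
    · simp only [Algebra.TensorProduct.tmul_mul_tmul, mul_one, one_mul]
      rw [h.k_e i j, TensorProduct.tmul_smul]
    · simp only [Algebra.TensorProduct.tmul_mul_tmul, mul_one, one_mul]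
      rw [h.k_e i i, TensorProduct.tmul_smul, pow2]
    · have := serre_mul_eq_zero (D.qi_generic i) (D.serreDeg i j) 1 1 (D.E i ⊗ₜ[ℂ] (1 : D.Uq))
        ((1 : D.Uq) ⊗ₜ[ℂ] D.K i) (D.E j ⊗ₜ[ℂ] (1 : D.Uq)) ((1 : D.Uq) ⊗ₜ[ℂ] D.K j)
        (by simp [h.comm i j]) (by simp) (by simp) (by simp)
        (tsE i j hij Algebra.TensorProduct.includeLeft)
      simpa using this
    · exact tsE i j hij Algebra.TensorProduct.includeRight
  · have hz := D.qi_serreDeg hij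
    rw [add_comm (D.F i ⊗ₜ[ℂ] (1 : D.Uq)), add_comm (D.F j ⊗ₜ[ℂ] (1 : D.Uq))]
    refine serre_coprod (D.qi_generic i) _ _ hz _ _ _ _ ?_ ?_ ?_ ?_ ?_
    · simp only [Algebra.TensorProduct.tmul_mul_tmul, mul_one, one_mul]
      rw [h.k'_f j i, TensorProduct.smul_tmul', D.qi_symm]
    · simp only [Algebra.TensorProduct.tmul_mul_tmul, mul_one, one_mul]
      rw [h.k'_f i j, TensorProduct.smul_tmul']
    · simp only [Algebra.TensorProduct.tmul_mul_tmul, mul_one, one_mul]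
      rw [h.k'_f i i, TensorProduct.smul_tmul', pow2]
    · have := serre_mul_eq_zero (D.qi_generic i) (D.serreDeg i j) 1 1 ((1 : D.Uq) ⊗ₜ[ℂ] D.F i)
        (D.K' i ⊗ₜ[ℂ] (1 : D.Uq)) ((1 : D.Uq) ⊗ₜ[ℂ] D.F j) (D.K' j ⊗ₜ[ℂ] (1 : D.Uq))
        (by simp [h.k'_k' i j]) (by simp) (by simp) (by simp)
        (tsF i j hij Algebra.TensorProduct.includeRight)
      simpa using this
    · exact tsF i j hij Algebra.TensorProduct.includeLeft

/-- The coproduct. -/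
def comulHom : D.Uq →ₐ[ℂ] D.Uq ⊗[ℂ] D.Uq := lift (comul_relations (D := D))

theorem counit_relations : D.Relations (R := ℂ) (fun _ => 0) (fun _ => 0) (fun _ => 1)
    (fun _ => 1) where
  kk' _ := one_mul 1
  k'k _ := one_mul 1
  comm _ _ := rfl
  ke _ _ := by simp
  kf _ _ := by simp
  ef _ _ := by simp
  serreE _ _ _ := by simp [serre]
  serreF _ _ _ := by simp [serre]

/-- The counit. -/
def counitHom : D.Uq →ₐ[ℂ] ℂ := lift (counit_relations (D := D))

instance : Bialgebra ℂ D.Uq := Bialgebra.ofAlgHom comulHom counitHom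
  (by
    apply algHom_ext <;> intro i <;>
      simp [comulHom, TensorProduct.add_tmul, TensorProduct.tmul_add, add_assoc,
        Algebra.TensorProduct.one_def])
  (by apply algHom_ext <;> intro i <;> simp [comulHom, counitHom])
  (by apply algHom_ext <;> intro i <;> simp [comulHom, counitHom])

theorem antipode_relations : D.Relations (R := D.Uqᵐᵒᵖ)
    (fun i => .op (-(D.E i * D.K' i))) (fun i => .op (-(D.K i * D.F i)))
    (fun i => .op (D.K' i)) (fun i => .op (D.K i)) := by
  have h := D.relations
  refine ⟨fun i => ?_, fun i => ?_, fun i j => ?_, fun i j => ?_, fun i j => ?_, fun i j => ?_,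
    fun i j hij => ?_, fun i j hij => ?_⟩
  · rw [← MulOpposite.op_mul, h.kk', MulOpposite.op_one]
  · rw [← MulOpposite.op_mul, h.k'k, MulOpposite.op_one]
  · rw [← MulOpposite.op_mul, ← MulOpposite.op_mul, h.k'_k']
  · rw [← MulOpposite.op_mul, ← MulOpposite.op_mul, ← MulOpposite.op_smul]
    congr 1
    rw [neg_mul, mul_neg, smul_neg, mul_assoc, h.k'_k', ← mul_assoc, ← mul_assoc, h.ke,
      smul_mul_assoc]
  · rw [← MulOpposite.op_mul, ← MulOpposite.op_mul, ← MulOpposite.op_smul]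
    congr 1
    rw [neg_mul, mul_neg, smul_neg, mul_assoc, ← mul_assoc, h.comm, mul_assoc, ← mul_assoc (D.K i),
      h.kf, mul_smul_comm]
  · rw [← MulOpposite.op_mul, ← MulOpposite.op_mul, ← MulOpposite.op_sub, neg_mul_neg, neg_mul_neg,
      ← neg_sub, h.ef_tw]
    split_ifs with hij
    · rw [← smul_neg, neg_sub, MulOpposite.op_smul, MulOpposite.op_sub]
    · simp
  · rw [serre_op, ← neg_one_smul ℂ (D.E i * _), ← neg_one_smul ℂ (D.E j * _), serre_smul, h.twE hij]
    simp
  · rw [serre_op, h.k_f, h.k_f, ← smul_neg, ← smul_neg, ← neg_one_smul ℂ (D.F i * _),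
      ← neg_one_smul ℂ (D.F j * _), smul_smul, smul_smul, serre_smul, h.twF hij]
    simp

/-- The antipode, as an anti-homomorphism. -/
def antipodeHom : D.Uq →ₐ[ℂ] D.Uqᵐᵒᵖ := lift (antipode_relations (D := D))

theorem antipodeInv_relations : D.Relations (R := D.Uqᵐᵒᵖ)
    (fun i => .op (-(D.K' i * D.E i))) (fun i => .op (-(D.F i * D.K i)))
    (fun i => .op (D.K' i)) (fun i => .op (D.K i)) := by
  have h := D.relations
  refine ⟨fun i => ?_, fun i => ?_, fun i j => ?_, fun i j => ?_, fun i j => ?_, fun i j => ?_,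
    fun i j hij => ?_, fun i j hij => ?_⟩
  · rw [← MulOpposite.op_mul, h.kk', MulOpposite.op_one]
  · rw [← MulOpposite.op_mul, h.k'k, MulOpposite.op_one]
  · rw [← MulOpposite.op_mul, ← MulOpposite.op_mul, h.k'_k']
  · rw [← MulOpposite.op_mul, ← MulOpposite.op_mul, ← MulOpposite.op_smul]
    congr 1
    rw [neg_mul, mul_neg, smul_neg, mul_assoc, ← mul_assoc, ← h.k'_k, mul_assoc,
      ← mul_assoc (D.K i), h.ke, mul_smul_comm]
  · rw [← MulOpposite.op_mul, ← MulOpposite.op_mul, ← MulOpposite.op_smul]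
    congr 1
    rw [neg_mul, mul_neg, smul_neg, mul_assoc, ← h.k'_k, ← mul_assoc, ← mul_assoc, h.kf,
      smul_mul_assoc]
  · rw [← MulOpposite.op_mul, ← MulOpposite.op_mul, ← MulOpposite.op_sub, neg_mul_neg, neg_mul_neg,
      h.ef_tw']
    split_ifs with hij
    · rw [MulOpposite.op_smul, MulOpposite.op_sub]
    · simp
  · rw [serre_op, h.k'_e, h.k'_e, ← smul_neg, ← smul_neg, ← neg_one_smul ℂ (D.E i * _),
      ← neg_one_smul ℂ (D.E j * _), smul_smul, smul_smul, serre_smul, h.twE hij]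
    simp
  · rw [serre_op, ← neg_one_smul ℂ (D.F i * _), ← neg_one_smul ℂ (D.F j * _), serre_smul, h.twF hij]
    simp

/-- The inverse of the antipode, as an anti-homomorphism. -/
def antipodeInvHom : D.Uq →ₐ[ℂ] D.Uqᵐᵒᵖ := lift (antipodeInv_relations (D := D))

/-- The antipode, as a linear map. -/
def antipodeLin : D.Uq →ₗ[ℂ] D.Uq :=
  (MulOpposite.opLinearEquiv ℂ).symm.toLinearMap ∘ₗ antipodeHom.toLinearMap

/-- The inverse of the antipode, as a linear map. -/
def antipodeInvLin : D.Uq →ₗ[ℂ] D.Uq :=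
  (MulOpposite.opLinearEquiv ℂ).symm.toLinearMap ∘ₗ antipodeInvHom.toLinearMap

theorem antipodeLin_mul (x y : D.Uq) :
    antipodeLin (x * y) = antipodeLin y * antipodeLin x := by
  simp [antipodeLin]

theorem antipodeInvLin_mul (x y : D.Uq) :
    antipodeInvLin (x * y) = antipodeInvLin y * antipodeInvLin x := by
  simp [antipodeInvLin]

@[simp] theorem antipodeLin_one : antipodeLin (1 : D.Uq) = 1 := by simp [antipodeLin]

@[simp] theorem antipodeLin_E (i : ι) : antipodeLin (D.E i) = -(D.E i * D.K' i) := by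
  simp [antipodeLin, antipodeHom]

@[simp] theorem antipodeLin_F (i : ι) : antipodeLin (D.F i) = -(D.K i * D.F i) := by
  simp [antipodeLin, antipodeHom]

@[simp] theorem antipodeLin_K (i : ι) : antipodeLin (D.K i) = D.K' i := by
  simp [antipodeLin, antipodeHom]

@[simp] theorem antipodeLin_K' (i : ι) : antipodeLin (D.K' i) = D.K i := by
  simp [antipodeLin, antipodeHom]

@[simp] theorem antipodeInvLin_one : antipodeInvLin (1 : D.Uq) = 1 := by simp [antipodeInvLin]

@[simp] theorem antipodeInvLin_E (i : ι) : antipodeInvLin (D.E i) = -(D.K' i * D.E i) := by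
  simp [antipodeInvLin, antipodeInvHom]

@[simp] theorem antipodeInvLin_F (i : ι) : antipodeInvLin (D.F i) = -(D.F i * D.K i) := by
  simp [antipodeInvLin, antipodeInvHom]

@[simp] theorem antipodeInvLin_K (i : ι) : antipodeInvLin (D.K i) = D.K' i := by
  simp [antipodeInvLin, antipodeInvHom]

@[simp] theorem antipodeInvLin_K' (i : ι) : antipodeInvLin (D.K' i) = D.K i := by
  simp [antipodeInvLin, antipodeInvHom]

theorem antipode_antipodeInv (x : D.Uq) : antipodeLin (antipodeInvLin x) = x := by
  have h := D.relations
  induction x using induction_gen with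
  | h1 => simp
  | hE i x ih =>
    rw [antipodeInvLin_mul, antipodeLin_mul, ih]
    simp [antipodeLin_mul, mul_assoc, h.k'k]
  | hF i x ih =>
    rw [antipodeInvLin_mul, antipodeLin_mul, ih]
    simp [antipodeLin_mul, ← mul_assoc, h.k'k]
  | hK i x ih => rw [antipodeInvLin_mul, antipodeLin_mul, ih]; simp
  | hK' i x ih => rw [antipodeInvLin_mul, antipodeLin_mul, ih]; simp
  | hadd x y hx hy => rw [map_add, map_add, hx, hy]
  | hsmul c x hx => rw [map_smul, map_smul, hx]

theorem antipodeInv_antipode (x : D.Uq) : antipodeInvLin (antipodeLin x) = x := by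
  have h := D.relations
  induction x using induction_gen with
  | h1 => simp
  | hE i x ih =>
    rw [antipodeLin_mul, antipodeInvLin_mul, ih]
    simp [antipodeInvLin_mul, ← mul_assoc, h.kk']
  | hF i x ih =>
    rw [antipodeLin_mul, antipodeInvLin_mul, ih]
    simp [antipodeInvLin_mul, mul_assoc, h.kk']
  | hK i x ih => rw [antipodeLin_mul, antipodeInvLin_mul, ih]; simp
  | hK' i x ih => rw [antipodeLin_mul, antipodeInvLin_mul, ih]; simp
  | hadd x y hx hy => rw [map_add, map_add, hx, hy]
  | hsmul c x hx => rw [map_smul, map_smul, hx]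

theorem comul_eq (x : D.Uq) : Coalgebra.comul (R := ℂ) x = comulHom x := rfl

theorem counit_eq (x : D.Uq) : Coalgebra.counit (R := ℂ) x = counitHom x := rfl

theorem antipode_left (t s : D.Uq ⊗[ℂ] D.Uq) (c : ℂ)
    (ht : LinearMap.mul' ℂ D.Uq (antipodeLin.rTensor D.Uq t) = algebraMap ℂ D.Uq c) :
    LinearMap.mul' ℂ D.Uq (antipodeLin.rTensor D.Uq (t * s)) =
      c • LinearMap.mul' ℂ D.Uq (antipodeLin.rTensor D.Uq s) := by
  induction s using TensorProduct.induction_on with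
  | zero => simp
  | add a b ha hb => simp only [mul_add, map_add, ha, hb, smul_add]
  | tmul a b =>
    have key : LinearMap.mul' ℂ D.Uq (antipodeLin.rTensor D.Uq (t * (a ⊗ₜ b))) =
        antipodeLin a * LinearMap.mul' ℂ D.Uq (antipodeLin.rTensor D.Uq t) * b := by
      clear ht
      induction t using TensorProduct.induction_on with
      | zero => simp
      | add x y hx hy => simp only [add_mul, mul_add, map_add, hx, hy]
      | tmul x y => simp [antipodeLin_mul, mul_assoc]
    rw [key, ht, ← Algebra.commutes, mul_assoc, ← Algebra.smul_def]
    simp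

theorem antipode_right (t s : D.Uq ⊗[ℂ] D.Uq) (c : ℂ)
    (hs : LinearMap.mul' ℂ D.Uq (antipodeLin.lTensor D.Uq s) = algebraMap ℂ D.Uq c) :
    LinearMap.mul' ℂ D.Uq (antipodeLin.lTensor D.Uq (t * s)) =
      c • LinearMap.mul' ℂ D.Uq (antipodeLin.lTensor D.Uq t) := by
  induction t using TensorProduct.induction_on with
  | zero => simp
  | add a b ha hb => simp only [add_mul, map_add, ha, hb, smul_add]
  | tmul a b =>
    have key : LinearMap.mul' ℂ D.Uq (antipodeLin.lTensor D.Uq ((a ⊗ₜ b) * s)) =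
        a * LinearMap.mul' ℂ D.Uq (antipodeLin.lTensor D.Uq s) * antipodeLin b := by
      clear hs
      induction s using TensorProduct.induction_on with
      | zero => simp
      | add x y hx hy => simp only [add_mul, mul_add, map_add, hx, hy]
      | tmul x y => simp [antipodeLin_mul, mul_assoc]
    rw [key, hs, ← Algebra.commutes, mul_assoc, ← Algebra.smul_def]
    simp

theorem antipode_rTensor (x : D.Uq) :
    LinearMap.mul' ℂ D.Uq (antipodeLin.rTensor D.Uq (comulHom x)) =
      algebraMap ℂ D.Uq (counitHom x) := by
  have h := D.relations
  induction x using induction_gen with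
  | h1 => simp [Algebra.TensorProduct.one_def]
  | hE i x ih =>
    rw [map_mul, antipode_left _ _ 0 (by simp [comulHom, mul_assoc, h.k'k])]
    simp [counitHom]
  | hF i x ih =>
    rw [map_mul, antipode_left _ _ 0 (by simp [comulHom])]
    simp [counitHom]
  | hK i x ih =>
    rw [map_mul, antipode_left _ _ 1 (by simp [comulHom, h.k'k]), ih]
    simp [counitHom]
  | hK' i x ih =>
    rw [map_mul, antipode_left _ _ 1 (by simp [comulHom, h.kk']), ih]
    simp [counitHom]
  | hadd x y hx hy => simp only [map_add, hx, hy]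
  | hsmul c x hx => simp only [map_smul, hx, Algebra.algebraMap_eq_smul_one, smul_eq_mul, mul_smul]

theorem antipode_lTensor_gen (g x : D.Uq)
    (hg : LinearMap.mul' ℂ D.Uq (antipodeLin.lTensor D.Uq (comulHom g)) =
      algebraMap ℂ D.Uq (counitHom g))
    (hx : LinearMap.mul' ℂ D.Uq (antipodeLin.lTensor D.Uq (comulHom x)) =
      algebraMap ℂ D.Uq (counitHom x)) :
    LinearMap.mul' ℂ D.Uq (antipodeLin.lTensor D.Uq (comulHom (g * x))) =
      algebraMap ℂ D.Uq (counitHom (g * x)) := by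
  rw [map_mul, antipode_right _ _ _ hx, hg, map_mul, map_mul, ← Algebra.commutes, Algebra.smul_def]

theorem antipode_lTensor (x : D.Uq) :
    LinearMap.mul' ℂ D.Uq (antipodeLin.lTensor D.Uq (comulHom x)) =
      algebraMap ℂ D.Uq (counitHom x) := by
  have h := D.relations
  induction x using induction_gen with
  | h1 => simp [Algebra.TensorProduct.one_def]
  | hE i x ih =>
    exact antipode_lTensor_gen _ _ (by simp [comulHom, counitHom]) ih
  | hF i x ih =>
    exact antipode_lTensor_gen _ _ (by simp [comulHom, counitHom, ← mul_assoc, h.k'k]) ih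
  | hK i x ih => exact antipode_lTensor_gen _ _ (by simp [comulHom, counitHom, h.kk']) ih
  | hK' i x ih => exact antipode_lTensor_gen _ _ (by simp [comulHom, counitHom, h.k'k]) ih
  | hadd x y hx hy => simp only [map_add, hx, hy]
  | hsmul c x hx => simp only [map_smul, hx, Algebra.algebraMap_eq_smul_one, smul_eq_mul, mul_smul]

instance : HopfAlgebra ℂ D.Uq where
  antipode := antipodeLin
  mul_antipode_rTensor_comul := LinearMap.ext antipode_rTensor
  mul_antipode_lTensor_comul := LinearMap.ext antipode_lTensor

/-! ### The `*`-structure of the compact real form -/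

/-- The complex conjugate of a `ℂ`-algebra: the same ring, with `c` acting as its conjugate. -/
def ConjAlg (R : Type*) : Type _ := R

/-- The underlying element of `R`. -/
def ConjAlg.down {R : Type*} (x : ConjAlg R) : R := x

instance (R : Type*) [Ring R] : Ring (ConjAlg R) := inferInstanceAs (Ring R)

instance (R : Type*) [Ring R] [Algebra ℂ R] : Algebra ℂ (ConjAlg R) :=
  ((algebraMap ℂ R).comp (starRingEnd ℂ)).toAlgebra' fun c x =>
    Algebra.commutes (A := R) (starRingEnd ℂ c) x

theorem ConjAlg.smul_def {R : Type*} [Ring R] [Algebra ℂ R] (c : ℂ) (x : R) :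
    (c • (show ConjAlg R from x) : ConjAlg R) = (starRingEnd ℂ c • x : R) :=
  (Algebra.smul_def (A := R) (starRingEnd ℂ c) x).symm

theorem conj_qInt {q : ℂ} (hq : starRingEnd ℂ q = q) (n : ℕ) :
    starRingEnd ℂ (qInt q n) = qInt q n := by
  simp [qInt, hq]

theorem conj_qBinom {q : ℂ} (hq : starRingEnd ℂ q = q) (n k : ℕ) :
    starRingEnd ℂ (qBinom q n k) = qBinom q n k := by
  simp [qBinom, qFact, conj_qInt hq]

theorem ConjAlg.serre_eq {R : Type*} [Ring R] [Algebra ℂ R] {q : ℂ} (hq : starRingEnd ℂ q = q)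
    (m : ℕ) (e x : R) :
    serre q m (show ConjAlg R from e) (show ConjAlg R from x) = (serre q m e x : R) := by
  unfold serre
  refine Finset.sum_congr rfl fun k _ => ?_
  have h := ConjAlg.smul_def ((-1) ^ k * qBinom q m k) (e ^ (m - k) * x * e ^ k)
  rw [map_mul, conj_qBinom hq, map_pow, map_neg, map_one] at h
  exact h

/-- A family satisfying the relations in `R` also satisfies them in the conjugate algebra. -/
theorem Relations.conj {R : Type*} [Ring R] [Algebra ℂ R] {e f k k' : ι → R}
    (h : D.Relations e f k k') : D.Relations (R := ConjAlg R) e f k k' where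
  kk' := h.kk'
  k'k := h.k'k
  comm := h.comm
  ke i j := (h.ke i j).trans (by
    have := ConjAlg.smul_def (D.qi i ^ D.a i j) (e j)
    rw [map_zpow₀, D.conj_qi] at this
    exact this.symm)
  kf i j := (h.kf i j).trans (by
    have := ConjAlg.smul_def (D.qi i ^ (-D.a i j)) (f j)
    rw [map_zpow₀, D.conj_qi] at this
    exact this.symm)
  ef i j := (h.ef i j).trans (by
    split_ifs
    · have := ConjAlg.smul_def ((D.qi i - (D.qi i)⁻¹)⁻¹) (k i - k' i)
      rw [map_inv₀, map_sub, map_inv₀, D.conj_qi] at this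
      exact this.symm
    · rfl)
  serreE i j hij := (ConjAlg.serre_eq (D.conj_qi i) _ _ _).trans (h.serreE i j hij)
  serreF i j hij := (ConjAlg.serre_eq (D.conj_qi i) _ _ _).trans (h.serreF i j hij)

theorem star_relations : D.Relations (R := D.Uqᵐᵒᵖ)
    (fun i => .op (D.K i * D.F i)) (fun i => .op (D.E i * D.K' i))
    (fun i => .op (D.K i)) (fun i => .op (D.K' i)) := by
  have h := D.relations
  have hKc (i : ι) (x : D.Uq) (j : ι) {c : ℂ} (hx : D.K i * x * D.K' i = c • x) (hc : c ≠ 0) :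
      D.K' i * x * D.K i = c⁻¹ • x := by
    have h1 := conj_to_comm (h.k'k i) hx
    have h2 := comm_inv hc (h.k'k i) (h.kk' i) h1
    rw [h2, smul_mul_assoc, mul_assoc, h.k'k, mul_one]
  refine ⟨fun i => ?_, fun i => ?_, fun i j => ?_, fun i j => ?_, fun i j => ?_, fun i j => ?_,
    fun i j hij => ?_, fun i j hij => ?_⟩
  · rw [← MulOpposite.op_mul, h.k'k, MulOpposite.op_one]
  · rw [← MulOpposite.op_mul, h.kk', MulOpposite.op_one]
  · rw [← MulOpposite.op_mul, ← MulOpposite.op_mul, h.comm]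
  · rw [← MulOpposite.op_mul, ← MulOpposite.op_mul, ← MulOpposite.op_smul]
    congr 1
    have hc := zpow_ne_zero (-D.a i j) (D.qi_ne_zero i)
    have := hKc i (D.F j) j (h.kf i j) hc
    rw [zpow_neg, inv_inv] at this
    rw [← mul_assoc (D.K' i), ← mul_assoc (D.K' i), h.k'_k, mul_assoc, mul_assoc, ← mul_assoc (D.K' i), this, mul_smul_comm]
  · rw [← MulOpposite.op_mul, ← MulOpposite.op_mul, ← MulOpposite.op_smul]
    congr 1
    have hc := zpow_ne_zero (D.a i j) (D.qi_ne_zero i)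
    have := hKc i (D.E j) j (h.ke i j) hc
    rw [← zpow_neg] at this
    rw [mul_assoc (D.E j), h.k'_k, ← mul_assoc, ← mul_assoc, this, smul_mul_assoc]
  · rw [← MulOpposite.op_mul, ← MulOpposite.op_mul, ← MulOpposite.op_sub, h.ef_tw]
    by_cases hij : i = j
    · subst hij
      rw [if_pos rfl, if_pos rfl, MulOpposite.op_smul, MulOpposite.op_sub]
    · rw [if_neg hij, if_neg (Ne.symm hij), MulOpposite.op_zero]
  · rw [serre_op, h.k_f, h.k_f, serre_smul, h.twF hij]
    simp
  · rw [serre_op, h.twE hij]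
    simp

/-- The `*`-operation as an algebra map to the conjugate of the opposite algebra. -/
def starHom : D.Uq →ₐ[ℂ] ConjAlg D.Uqᵐᵒᵖ := lift (star_relations (D := D)).conj

/-- The `*`-operation of the compact real form: the conjugate-linear anti-homomorphism with
`K_i* = K_i`, `E_i* = K_i F_i`, `F_i* = E_i K_i⁻¹`. -/
def starU (x : D.Uq) : D.Uq := MulOpposite.unop (starHom x).down

theorem starU_mul (x y : D.Uq) : starU (x * y) = starU y * starU x := by
  unfold starU
  rw [map_mul]
  rfl

theorem starU_add (x y : D.Uq) : starU (x + y) = starU x + starU y := by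
  unfold starU
  rw [map_add]
  rfl

theorem starU_smul (c : ℂ) (x : D.Uq) : starU (c • x) = starRingEnd ℂ c • starU x := by
  unfold starU
  rw [map_smul]
  exact congrArg MulOpposite.unop
    (ConjAlg.smul_def (R := D.Uqᵐᵒᵖ) c (starHom x).down)

@[simp] theorem starU_one : starU (1 : D.Uq) = 1 := by
  unfold starU
  rw [map_one]
  rfl

theorem starU_E (i : ι) : starU (D.E i) = D.K i * D.F i :=
  congrArg (fun y => MulOpposite.unop (ConjAlg.down y)) (lift_E star_relations.conj i)

theorem starU_F (i : ι) : starU (D.F i) = D.E i * D.K' i :=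
  congrArg (fun y => MulOpposite.unop (ConjAlg.down y)) (lift_F star_relations.conj i)

theorem starU_K (i : ι) : starU (D.K i) = D.K i :=
  congrArg (fun y => MulOpposite.unop (ConjAlg.down y)) (lift_K star_relations.conj i)

theorem starU_K' (i : ι) : starU (D.K' i) = D.K' i :=
  congrArg (fun y => MulOpposite.unop (ConjAlg.down y)) (lift_K' star_relations.conj i)

/-- `K_i` as a unit. -/
def unitK (i : ι) : D.Uqˣ := ⟨D.K i, D.K' i, D.relations.kk' i, D.relations.k'k i⟩

theorem unitK_comm (i j : ι) : Commute (D.unitK i) (D.unitK j) :=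
  Units.ext (D.relations.comm i j)

variable (D) in
/-- `K_λ = K_1^{n_1} ⋯ K_r^{n_r}` for `λ = ∑ n_i α_i`. -/
def Klam [Fintype ι] (n : ι → ℤ) : D.Uqˣ :=
  Finset.univ.noncommProd (fun i => D.unitK i ^ n i)
    fun i _ j _ _ => (unitK_comm i j).zpow_zpow (n i) (n j)

/-! ### Representations and the quantized coordinate ring -/

section Rep

variable {V : Type*} [AddCommGroup V] [Module ℂ V]

/-- `v` has weight `μ`, where the integral weight `μ` is given by the integers
`μ i = 2 (μ, α_i) / (α_i, α_i)`, so that `q_i ^ μ_i = q ^ (μ, α_i)`. -/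
def IsWeightVector (π : D.Uq →ₐ[ℂ] Module.End ℂ V) (μ : ι → ℤ) (v : V) : Prop :=
  ∀ i, π (D.K i) v = (D.qi i ^ μ i) • v

/-- The representation is spanned by vectors of integral weight ("type 1"). -/
def IsTypeOne (π : D.Uq →ₐ[ℂ] Module.End ℂ V) : Prop :=
  Submodule.span ℂ {v : V | ∃ μ, IsWeightVector π μ v} = ⊤

/-- Irreducible representations `V(Λ)` of highest weight `Λ`, for a dominant integral weight `Λ`
with coordinates `Λ i = 2 (Λ, α_i) / (α_i, α_i)`. -/
structure IsIrreducibleOfHighestWeight (π : D.Uq →ₐ[ℂ] Module.End ℂ V) (Λ : ι → ℕ) : Prop where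
  irreducible : ∀ W : Submodule ℂ V, (∀ X, ∀ w ∈ W, π X w ∈ W) → W = ⊥ ∨ W = ⊤
  highest : ∃ v : V, v ≠ 0 ∧ (∀ i, π (D.E i) v = 0) ∧ IsWeightVector π (fun i => (Λ i : ℤ)) v

theorem IsWeightVector.k' {π : D.Uq →ₐ[ℂ] Module.End ℂ V} {μ : ι → ℤ} {v : V}
    (h : IsWeightVector π μ v) (i : ι) : π (D.K' i) v = (D.qi i ^ (-μ i)) • v := by
  have h1 : π (D.K' i) (π (D.K i) v) = v := by
    rw [← Module.End.mul_apply, ← map_mul, D.relations.k'k, map_one, Module.End.one_apply]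
  rw [h i, map_smul] at h1
  rw [zpow_neg]
  conv_rhs => rw [← h1]
  rw [smul_smul, inv_mul_cancel₀ (zpow_ne_zero _ (D.qi_ne_zero i)), one_smul]

/-- A highest weight irreducible representation is spanned by its weight vectors. -/
theorem IsIrreducibleOfHighestWeight.isTypeOne {π : D.Uq →ₐ[ℂ] Module.End ℂ V} {Λ : ι → ℕ}
    (h : IsIrreducibleOfHighestWeight π Λ) : IsTypeOne π := by
  have hr := D.relations
  have key : ∀ X : D.Uq, ∀ w ∈ Submodule.span ℂ {v : V | ∃ μ, IsWeightVector π μ v},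
      π X w ∈ Submodule.span ℂ {v : V | ∃ μ, IsWeightVector π μ v} := by
    have gen : ∀ g : D.Uq, (∀ v μ, IsWeightVector π μ v → ∃ μ', IsWeightVector π μ' (π g v)) →
        ∀ w ∈ Submodule.span ℂ {v : V | ∃ μ, IsWeightVector π μ v},
          π g w ∈ Submodule.span ℂ {v : V | ∃ μ, IsWeightVector π μ v} := by
      intro g hg w hw
      induction hw using Submodule.span_induction with
      | mem x hx =>
        obtain ⟨μ, hμ⟩ := hx
        exact Submodule.subset_span (hg x μ hμ)
      | zero => simp
      | add x y _ _ hx hy => rw [map_add]; exact add_mem hx hy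
      | smul c x _ hx => rw [map_smul]; exact Submodule.smul_mem _ _ hx
    have shift : ∀ (g : D.Uq) (ν : ι → ℤ), (∀ i, D.K i * g = (D.qi i ^ ν i) • (g * D.K i)) →
        ∀ v μ, IsWeightVector π μ v → ∃ μ', IsWeightVector π μ' (π g v) := by
      intro g ν hν v μ hv
      refine ⟨fun i => ν i + μ i, fun i => ?_⟩
      rw [← Module.End.mul_apply, ← map_mul, hν i, map_smul, map_mul, LinearMap.smul_apply,
        Module.End.mul_apply, hv i, map_smul, smul_smul, zpow_add₀ (D.qi_ne_zero i)]
    intro X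
    induction X using induction_gen with
    | h1 => intro w hw; simpa using hw
    | hE i x ih =>
      intro w hw
      rw [map_mul, Module.End.mul_apply]
      exact gen _ (shift _ (fun j => D.a j i) fun j => hr.k_e j i) _ (ih w hw)
    | hF i x ih =>
      intro w hw
      rw [map_mul, Module.End.mul_apply]
      exact gen _ (shift _ (fun j => -D.a j i) fun j => hr.k_f j i) _ (ih w hw)
    | hK i x ih =>
      intro w hw
      rw [map_mul, Module.End.mul_apply]
      exact gen _ (shift _ (fun _ => 0) fun j => by rw [zpow_zero, one_smul, hr.comm]) _ (ih w hw)
    | hK' i x ih =>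
      intro w hw
      rw [map_mul, Module.End.mul_apply]
      exact gen _ (shift _ (fun _ => 0) fun j => by rw [zpow_zero, one_smul, hr.k'_k]) _ (ih w hw)
    | hadd x y hx hy =>
      intro w hw
      rw [map_add, LinearMap.add_apply]
      exact add_mem (hx w hw) (hy w hw)
    | hsmul c x hx =>
      intro w hw
      rw [map_smul, LinearMap.smul_apply]
      exact Submodule.smul_mem _ _ (hx w hw)
  refine (h.irreducible _ key).resolve_left fun hbot => ?_
  obtain ⟨v, hv0, -, hv⟩ := h.highest
  have : v ∈ Submodule.span ℂ {v : V | ∃ μ, IsWeightVector π μ v} :=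
    Submodule.subset_span ⟨_, hv⟩
  rw [hbot, Submodule.mem_bot] at this
  exact hv0 this

/-- The matrix coefficient `c_{f,v}(X) = f(X ▷ v)`. Linear functionals on `U_q(𝔤)` carry the
convolution product `(φ ψ)(X) = (φ ⊗ ψ)(Δ(X))`. -/
def coeff (π : D.Uq →ₐ[ℂ] Module.End ℂ V) (f : Module.Dual ℂ V) (v : V) :
    WithConv (D.Uq →ₗ[ℂ] ℂ) :=
  WithConv.toConv (f ∘ₗ π.toLinearMap.flip v)

@[simp] theorem coeff_apply (π : D.Uq →ₐ[ℂ] Module.End ℂ V) (f : Module.Dual ℂ V) (v : V)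
    (X : D.Uq) : coeff π f v X = f (π X v) := rfl

end Rep

variable (D) in
/-- The span of the matrix coefficients of finite-dimensional (type 1) representations. -/
def coeffSpan : Submodule ℂ (WithConv (D.Uq →ₗ[ℂ] ℂ)) :=
  Submodule.span ℂ {φ | ∃ (n : ℕ) (π : D.Uq →ₐ[ℂ] Module.End ℂ (Fin n → ℂ)), IsTypeOne π ∧
    ∃ (f : Module.Dual ℂ (Fin n → ℂ)) (v : Fin n → ℂ), φ = coeff π f v}

theorem coeff_mem {V : Type*} [AddCommGroup V] [Module ℂ V] [FiniteDimensional ℂ V]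
    {π : D.Uq →ₐ[ℂ] Module.End ℂ V} (hπ : IsTypeOne π) (f : Module.Dual ℂ V) (v : V) :
    coeff π f v ∈ D.coeffSpan := by
  let e : V ≃ₗ[ℂ] (Fin (Module.finrank ℂ V) → ℂ) := (Module.finBasis ℂ V).equivFun
  refine Submodule.subset_span ⟨_, (LinearEquiv.conjAlgEquiv ℂ e).toAlgHom.comp π, ?_,
    f ∘ₗ e.symm.toLinearMap, e v, ?_⟩
  · unfold IsTypeOne at hπ ⊢
    rw [eq_top_iff] at hπ ⊢
    intro w _
    have h1 : e.symm w ∈ Submodule.span ℂ {v : V | ∃ μ, IsWeightVector π μ v} := hπ trivial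
    have h2 := Submodule.mem_map_of_mem (f := e.toLinearMap) h1
    rw [Submodule.map_span] at h2
    have h3 : e.toLinearMap (e.symm w) = w := e.apply_symm_apply w
    rw [h3] at h2
    refine Submodule.span_mono ?_ h2
    rintro _ ⟨x, ⟨μ, hμ⟩, rfl⟩
    refine ⟨μ, fun i => ?_⟩
    simp [LinearEquiv.conjAlgEquiv_apply, hμ i]
  · ext X
    simp [LinearEquiv.conjAlgEquiv_apply]

theorem one_mem_coeffSpan : (1 : WithConv (D.Uq →ₗ[ℂ] ℂ)) ∈ D.coeffSpan := by
  have h : IsTypeOne ((Algebra.ofId ℂ (Module.End ℂ ℂ)).comp (counitHom (D := D))) := by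
    unfold IsTypeOne
    rw [eq_top_iff]
    intro w _
    refine Submodule.subset_span ⟨fun _ => 0, fun i => ?_⟩
    simp [counitHom]
  have := coeff_mem h LinearMap.id 1
  convert this using 1
  ext X
  simp [counit_eq, Algebra.ofId_apply]

/-- The tensor product of two representations. -/
def tensorRep {V W : Type*} [AddCommGroup V] [Module ℂ V] [AddCommGroup W] [Module ℂ W]
    (π : D.Uq →ₐ[ℂ] Module.End ℂ V) (σ : D.Uq →ₐ[ℂ] Module.End ℂ W) :
    D.Uq →ₐ[ℂ] Module.End ℂ (V ⊗[ℂ] W) :=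
  ((Module.endTensorEndAlgHom (R := ℂ) (A := ℂ) (M := V) (N := W)).comp
    (Algebra.TensorProduct.map π σ)).comp comulHom

theorem mul_mem_coeffSpan (φ ψ : WithConv (D.Uq →ₗ[ℂ] ℂ)) (hφ : φ ∈ D.coeffSpan)
    (hψ : ψ ∈ D.coeffSpan) : φ * ψ ∈ D.coeffSpan := by
  have h : φ * ψ ∈ D.coeffSpan * D.coeffSpan := Submodule.mul_mem_mul hφ hψ
  rw [coeffSpan, Submodule.span_mul_span] at h
  refine Submodule.span_le.2 ?_ h
  rintro _ ⟨_, ⟨n, π, hπ, f, v, rfl⟩, _, ⟨m, σ, hσ, g, w, rfl⟩, rfl⟩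
  have hT : IsTypeOne (tensorRep π σ) := by
    unfold IsTypeOne at hπ hσ ⊢
    rw [eq_top_iff, ← TensorProduct.map₂_mk_top_top_eq_top, ← hπ, ← hσ, Submodule.map₂_span_span]
    refine Submodule.span_mono ?_
    rintro _ ⟨x, ⟨μ, hμ⟩, y, ⟨ν, hν⟩, rfl⟩
    refine ⟨fun i => μ i + ν i, fun i => ?_⟩
    have h1 : tensorRep π σ (D.K i) (x ⊗ₜ y) = (π (D.K i) x) ⊗ₜ (σ (D.K i) y) := by
      simp [tensorRep, comulHom, Module.endTensorEndAlgHom_apply]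
    change tensorRep π σ (D.K i) (x ⊗ₜ y) = _ • (x ⊗ₜ y)
    rw [h1, hμ i, hν i, zpow_add₀ (D.qi_ne_zero i), TensorProduct.smul_tmul_smul]
  have := coeff_mem hT (LinearMap.mul' ℂ ℂ ∘ₗ TensorProduct.map f g) (v ⊗ₜ w)
  suffices he : coeff π f v * coeff σ g w = coeff (tensorRep π σ)
      (LinearMap.mul' ℂ ℂ ∘ₗ TensorProduct.map f g) (v ⊗ₜ w) by
    rw [← he] at this
    exact this
  ext X
  simp only [LinearMap.convMul_apply, coeff_apply, comul_eq, tensorRep, AlgHom.comp_apply]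
  generalize comulHom X = t
  induction t using TensorProduct.induction_on with
  | zero => simp
  | add a b ha hb => simp only [map_add, LinearMap.add_apply, ha, hb]
  | tmul a b => simp [Module.endTensorEndAlgHom_apply]

variable (D) in
/-- The quantized coordinate ring `ℂ_q[G]`. -/
def CqG : Subalgebra ℂ (WithConv (D.Uq →ₗ[ℂ] ℂ)) :=
  D.coeffSpan.toSubalgebra one_mem_coeffSpan mul_mem_coeffSpan

theorem mem_CqG {φ : WithConv (D.Uq →ₗ[ℂ] ℂ)} : φ ∈ D.CqG ↔ φ ∈ D.coeffSpan := Iff.rfl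

/-- To show that an additive, (conjugate-)homogeneous operation preserves `ℂ_q[G]` it is enough to
look at matrix coefficients. -/
theorem CqG_induction {p : WithConv (D.Uq →ₗ[ℂ] ℂ) → Prop}
    (hc : ∀ (n : ℕ) (π : D.Uq →ₐ[ℂ] Module.End ℂ (Fin n → ℂ)), IsTypeOne π →
      ∀ f v, p (coeff π f v))
    (h0 : p 0) (hadd : ∀ x y, p x → p y → p (x + y)) (hsmul : ∀ (c : ℂ) x, p x → p (c • x))
    (φ : WithConv (D.Uq →ₗ[ℂ] ℂ)) (h : φ ∈ D.CqG) : p φ := by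
  rw [mem_CqG, coeffSpan] at h
  induction h using Submodule.span_induction with
  | mem x hx =>
    obtain ⟨n, π, hπ, f, v, rfl⟩ := hx
    exact hc n π hπ f v
  | zero => exact h0
  | add x y _ _ hx hy => exact hadd x y hx hy
  | smul c x _ hx => exact hsmul c x hx

/-- `φ ◁ X`, i.e. `(φ ◁ X)(Y) = φ(XY)`. -/
def rightActDual : D.Uq →ₗ[ℂ] WithConv (D.Uq →ₗ[ℂ] ℂ) →ₗ[ℂ] WithConv (D.Uq →ₗ[ℂ] ℂ) :=
  LinearMap.mk₂ ℂ (fun X φ => WithConv.toConv (φ.ofConv ∘ₗ LinearMap.mulLeft ℂ X))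
    (fun _ _ _ => by ext; simp [add_mul]) (fun _ _ _ => by ext; simp)
    (fun _ _ _ => by ext; simp) (fun _ _ _ => by ext; simp)

/-- `X ▷ φ`, i.e. `(X ▷ φ)(Y) = φ(YX)`. -/
def leftActDual : D.Uq →ₗ[ℂ] WithConv (D.Uq →ₗ[ℂ] ℂ) →ₗ[ℂ] WithConv (D.Uq →ₗ[ℂ] ℂ) :=
  LinearMap.mk₂ ℂ (fun X φ => WithConv.toConv (φ.ofConv ∘ₗ LinearMap.mulRight ℂ X))
    (fun _ _ _ => by ext; simp [mul_add]) (fun _ _ _ => by ext; simp)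
    (fun _ _ _ => by ext; simp) (fun _ _ _ => by ext; simp)

@[simp] theorem rightActDual_apply (X : D.Uq) (φ : WithConv (D.Uq →ₗ[ℂ] ℂ)) (Y : D.Uq) :
    rightActDual X φ Y = φ (X * Y) := rfl

@[simp] theorem leftActDual_apply (X : D.Uq) (φ : WithConv (D.Uq →ₗ[ℂ] ℂ)) (Y : D.Uq) :
    leftActDual X φ Y = φ (Y * X) := rfl

/-- `φ*(X) = conj (φ(S(X)*))`. -/
def starDual (φ : WithConv (D.Uq →ₗ[ℂ] ℂ)) : WithConv (D.Uq →ₗ[ℂ] ℂ) :=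
  WithConv.toConv
    { toFun := fun X => starRingEnd ℂ (φ (starU (HopfAlgebra.antipode ℂ X)))
      map_add' := fun x y => by rw [map_add, starU_add, map_add, map_add]
      map_smul' := fun c x => by
        rw [map_smul, starU_smul, map_smul, smul_eq_mul, map_mul, Complex.conj_conj]; rfl }

@[simp] theorem starDual_apply (φ : WithConv (D.Uq →ₗ[ℂ] ℂ)) (X : D.Uq) :
    starDual φ X = starRingEnd ℂ (φ (starU (HopfAlgebra.antipode ℂ X))) := rfl

theorem antipode_eq : HopfAlgebra.antipode ℂ (A := D.Uq) = antipodeLin := rfl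

theorem rightActDual_mem (X : D.Uq) (φ : WithConv (D.Uq →ₗ[ℂ] ℂ)) (h : φ ∈ D.CqG) :
    rightActDual X φ ∈ D.CqG := by
  refine CqG_induction (p := fun φ => rightActDual X φ ∈ D.CqG) ?_ ?_ ?_ ?_ φ h
  · intro n π hπ f v
    have : rightActDual X (coeff π f v) = coeff π (f ∘ₗ π X) v := by ext Y; simp
    rw [this]
    exact coeff_mem hπ _ _
  · rw [map_zero]; exact zero_mem _
  · intro x y hx hy; rw [map_add]; exact add_mem hx hy
  · intro c x hx; rw [map_smul]; exact D.CqG.smul_mem hx c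

theorem leftActDual_mem (X : D.Uq) (φ : WithConv (D.Uq →ₗ[ℂ] ℂ)) (h : φ ∈ D.CqG) :
    leftActDual X φ ∈ D.CqG := by
  refine CqG_induction (p := fun φ => leftActDual X φ ∈ D.CqG) ?_ ?_ ?_ ?_ φ h
  · intro n π hπ f v
    have : leftActDual X (coeff π f v) = coeff π f (π X v) := by ext Y; simp
    rw [this]
    exact coeff_mem hπ _ _
  · rw [map_zero]; exact zero_mem _
  · intro x y hx hy; rw [map_add]; exact add_mem hx hy
  · intro c x hx; rw [map_smul]; exact D.CqG.smul_mem hx c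

/-- The representation `X ↦ conj ∘ π(S(X)*) ∘ conj` on `ℂⁿ`. -/
def conjRep {n : ℕ} (π : D.Uq →ₐ[ℂ] Module.End ℂ (Fin n → ℂ)) :
    D.Uq →ₐ[ℂ] Module.End ℂ (Fin n → ℂ) :=
  AlgHom.ofLinearMap
    { toFun := fun X =>
        { toFun := fun v => star (π (starU (antipodeLin X)) (star v))
          map_add' := fun v w => by rw [star_add, map_add, star_add]
          map_smul' := fun c v => by rw [star_smul, map_smul, star_smul, star_star]; rfl }
      map_add' := fun X Y => by
        refine LinearMap.ext fun v => ?_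
        simp [starU_add]
      map_smul' := fun c X => by
        refine LinearMap.ext fun v => ?_
        simp [starU_smul] }
    (LinearMap.ext fun v => by simp)
    (fun X Y => LinearMap.ext fun v => by simp [antipodeLin_mul, starU_mul])

theorem conjRep_apply {n : ℕ} (π : D.Uq →ₐ[ℂ] Module.End ℂ (Fin n → ℂ)) (X : D.Uq)
    (v : Fin n → ℂ) : conjRep π X v = star (π (starU (antipodeLin X)) (star v)) := rfl

theorem starDual_mem (φ : WithConv (D.Uq →ₗ[ℂ] ℂ)) (h : φ ∈ D.CqG) : starDual φ ∈ D.CqG := by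
  refine CqG_induction (p := fun φ => starDual φ ∈ D.CqG) ?_ ?_ ?_ ?_ φ h
  · intro n π hπ f v
    let g : Module.Dual ℂ (Fin n → ℂ) :=
      { toFun := fun w => starRingEnd ℂ (f (star w))
        map_add' := fun v w => by rw [star_add, map_add, map_add]
        map_smul' := fun c v => by rw [star_smul, map_smul, smul_eq_mul, map_mul]; simp }
    have : starDual (coeff π f v) = coeff (conjRep π) g (star v) := by
      ext X
      simp [conjRep_apply, g, antipode_eq]
    rw [this]
    refine coeff_mem ?_ _ _
    unfold IsTypeOne at hπ ⊢
    rw [eq_top_iff] at hπ ⊢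
    intro w _
    have hw : star w ∈ Submodule.span ℂ {v | ∃ μ, IsWeightVector π μ v} := hπ trivial
    rw [← star_star w]
    clear hπ
    generalize star w = u at hw
    induction hw using Submodule.span_induction with
    | mem x hx =>
      obtain ⟨μ, hμ⟩ := hx
      refine Submodule.subset_span ⟨fun i => -μ i, fun i => ?_⟩
      rw [conjRep_apply, antipodeLin_K, starU_K', star_star, hμ.k', star_smul]
      congr 1
      exact (map_zpow₀ (starRingEnd ℂ) _ _).trans (by rw [D.conj_qi])
    | zero => rw [star_zero]; exact zero_mem _
    | add x y _ _ hx hy => rw [star_add]; exact add_mem (hx) (hy)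
    | smul c x _ hx => rw [star_smul]; exact Submodule.smul_mem _ _ (hx)
  · have : starDual (0 : WithConv (D.Uq →ₗ[ℂ] ℂ)) = 0 := by ext X; simp
    rw [this]; exact zero_mem _
  · intro x y hx hy
    have : starDual (x + y) = starDual x + starDual y := by ext X; simp
    rw [this]; exact add_mem hx hy
  · intro c x hx
    have : starDual (c • x) = starRingEnd ℂ c • starDual x := by ext X; simp
    rw [this]; exact D.CqG.smul_mem hx _

/-- The `*`-operation of `ℂ_q[G]`. -/
def CqG.star (φ : D.CqG) : D.CqG := ⟨starDual φ.1, starDual_mem φ.1 φ.2⟩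

end Datum

/-! ### Module algebras, invariant matrices and equivariant `K₀` -/

/-- The (linear) inverse of the antipode of a Hopf algebra with bijective antipode. -/
class AntipodeInverse (U : Type*) [Ring U] [HopfAlgebra ℂ U] where
  inv : U →ₗ[ℂ] U
  antipode_inv : ∀ X, HopfAlgebra.antipode ℂ (inv X) = X
  inv_antipode : ∀ X, inv (HopfAlgebra.antipode ℂ X) = X

instance {ι : Type*} (D : Datum ι) : AntipodeInverse D.Uq where
  inv := Datum.antipodeInvLin
  antipode_inv := Datum.antipode_antipodeInv
  inv_antipode := Datum.antipodeInv_antipode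

/-- A right `U`-module algebra structure on `B`; `act X b` is `b ◁ X`. -/
structure RightModuleAlgebra (U B : Type*) [Ring U] [HopfAlgebra ℂ U] [Ring B] [Algebra ℂ B] where
  act : U →ₗ[ℂ] B →ₗ[ℂ] B
  act_one : ∀ b, act 1 b = b
  act_mul : ∀ X Y b, act (X * Y) b = act Y (act X b)
  /-- `1 ◁ X = ε(X) 1`. -/
  act_unit : ∀ X, act X 1 = Coalgebra.counit (R := ℂ) X • 1
  /-- `(a b) ◁ X = (a ◁ X₍₁₎) (b ◁ X₍₂₎)`. -/
  act_prod : ∀ X a b, act X (a * b) =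
    LinearMap.mul' ℂ B (TensorProduct.map (act.flip a) (act.flip b) (Coalgebra.comul (R := ℂ) X))

/-- A left `U`-module algebra structure on `B`; `act X b` is `X ▷ b`. -/
structure LeftModuleAlgebra (U B : Type*) [Ring U] [HopfAlgebra ℂ U] [Ring B] [Algebra ℂ B] where
  act : U →ₗ[ℂ] B →ₗ[ℂ] B
  act_one : ∀ b, act 1 b = b
  act_mul : ∀ X Y b, act (X * Y) b = act X (act Y b)
  /-- `X ▷ 1 = ε(X) 1`. -/
  act_unit : ∀ X, act X 1 = Coalgebra.counit (R := ℂ) X • 1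
  /-- `X ▷ (a b) = (X₍₁₎ ▷ a) (X₍₂₎ ▷ b)`. -/
  act_prod : ∀ X a b, act X (a * b) =
    LinearMap.mul' ℂ B (TensorProduct.map (act.flip a) (act.flip b) (Coalgebra.comul (R := ℂ) X))

section Invariant

variable {U B : Type*} [Ring U] [HopfAlgebra ℂ U] [Ring B] [Algebra ℂ B]
variable {l m n p : Type*} [Fintype l] [Fintype m] [Fintype n] [Fintype p]

/-- Matrix multiplication as a bilinear map. -/
def matMul : Matrix l m B →ₗ[ℂ] Matrix m n B →ₗ[ℂ] Matrix l n B :=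
  LinearMap.mk₂ ℂ (fun M N => M * N) (fun _ _ _ => Matrix.add_mul _ _ _)
    (fun _ _ _ => Matrix.smul_mul _ _ _) (fun _ _ _ => Matrix.mul_add _ _ _)
    (fun _ _ _ => Matrix.mul_smul _ _ _)

/-- `X ↦ f(X₍₁₎) g(X₍₂₎)` for matrix-valued `f` and `g`. -/
def matConv (f : U →ₗ[ℂ] Matrix l m B) (g : U →ₗ[ℂ] Matrix m n B) : U →ₗ[ℂ] Matrix l n B :=
  TensorProduct.lift (matMul.compl₁₂ f g) ∘ₗ Coalgebra.comul

/-- A scalar matrix-valued map, regarded as taking values in matrices over `B`. -/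
def scalarMat (B : Type*) [Ring B] [Algebra ℂ B] (ρ : U →ₗ[ℂ] Matrix l m ℂ) :
    U →ₗ[ℂ] Matrix l m B :=
  (Algebra.linearMap ℂ B).mapMatrix ∘ₗ ρ

/-- Entrywise action: `X ↦ T(X)(M)`. -/
def entrywise (T : U →ₗ[ℂ] B →ₗ[ℂ] B) (M : Matrix l m B) : U →ₗ[ℂ] Matrix l m B where
  toFun X := M.map (T X)
  map_add' X Y := by ext; simp
  map_smul' c X := by ext; simp

/-- An anti-representation `ρ°` of `U`, i.e. a representation of the opposite algebra, as a linear
map on `U`. -/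
def antiRep {N : ℕ} (ρ : Uᵐᵒᵖ →ₐ[ℂ] Matrix (Fin N) (Fin N) ℂ) :
    U →ₗ[ℂ] Matrix (Fin N) (Fin N) ℂ :=
  ρ.toLinearMap ∘ₗ (MulOpposite.opLinearEquiv ℂ).toLinearMap

variable [AntipodeInverse U] {N K : ℕ}

/-- `ad°_L(X)(M) = ρ°(X₍₁₎) (M ◁ X₍₂₎) σ°(S⁻¹(X₍₃₎))`; for square matrices one takes `σ = ρ`. -/
def adL (A : RightModuleAlgebra U B) (ρ : Uᵐᵒᵖ →ₐ[ℂ] Matrix (Fin N) (Fin N) ℂ)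
    (σ : Uᵐᵒᵖ →ₐ[ℂ] Matrix (Fin K) (Fin K) ℂ) (M : Matrix (Fin N) (Fin K) B) :
    U →ₗ[ℂ] Matrix (Fin N) (Fin K) B :=
  matConv (matConv (scalarMat B (antiRep ρ)) (entrywise A.act M))
    (scalarMat B (antiRep σ ∘ₗ AntipodeInverse.inv))

/-- `ad°_R(X)(M) = ρ°(S⁻¹(X₍₁₎)) (S⁻²(X₍₂₎) ▷ M) σ°(X₍₃₎)`; for square matrices one takes
`σ = ρ`. -/
def adR (A : LeftModuleAlgebra U B) (ρ : Uᵐᵒᵖ →ₐ[ℂ] Matrix (Fin N) (Fin N) ℂ)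
    (σ : Uᵐᵒᵖ →ₐ[ℂ] Matrix (Fin K) (Fin K) ℂ) (M : Matrix (Fin N) (Fin K) B) :
    U →ₗ[ℂ] Matrix (Fin N) (Fin K) B :=
  matConv (matConv (scalarMat B (antiRep ρ ∘ₗ AntipodeInverse.inv)) (entrywise (A.act ∘ₗ AntipodeInverse.inv ∘ₗ AntipodeInverse.inv) M))
    (scalarMat B (antiRep σ))

/-- Right `U`-invariance of a matrix, with respect to `ρ°` on rows and `σ°` on columns. -/
def IsRightInvariant (A : RightModuleAlgebra U B) (ρ : Uᵐᵒᵖ →ₐ[ℂ] Matrix (Fin N) (Fin N) ℂ)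
    (σ : Uᵐᵒᵖ →ₐ[ℂ] Matrix (Fin K) (Fin K) ℂ) (M : Matrix (Fin N) (Fin K) B) : Prop :=
  ∀ X : U, adL A ρ σ M X = Coalgebra.counit (R := ℂ) X • M

/-- Left `U`-invariance of a matrix, with respect to `ρ°` on rows and `σ°` on columns. -/
def IsLeftInvariant (A : LeftModuleAlgebra U B) (ρ : Uᵐᵒᵖ →ₐ[ℂ] Matrix (Fin N) (Fin N) ℂ)
    (σ : Uᵐᵒᵖ →ₐ[ℂ] Matrix (Fin K) (Fin K) ℂ) (M : Matrix (Fin N) (Fin K) B) : Prop :=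
  ∀ X : U, adR A ρ σ M X = Coalgebra.counit (R := ℂ) X • M

/-- A right `U`-invariant projection (idempotent matrix) over `B`, with its anti-representation. -/
structure RightInvariantProjection (A : RightModuleAlgebra U B) where
  size : ℕ
  rep : Uᵐᵒᵖ →ₐ[ℂ] Matrix (Fin size) (Fin size) ℂ
  mat : Matrix (Fin size) (Fin size) B
  idempotent : IsIdempotentElem mat
  invariant : IsRightInvariant A rep rep mat

/-- A left `U`-invariant projection (idempotent matrix) over `B`, with its anti-representation. -/
structure LeftInvariantProjection (A : LeftModuleAlgebra U B) where
  size : ℕ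
  rep : Uᵐᵒᵖ →ₐ[ℂ] Matrix (Fin size) (Fin size) ℂ
  mat : Matrix (Fin size) (Fin size) B
  idempotent : IsIdempotentElem mat
  invariant : IsLeftInvariant A rep rep mat

/-- Invariant Murray-von Neumann equivalence. -/
def RightInvariantProjection.Equiv {A : RightModuleAlgebra U B}
    (P Q : RightInvariantProjection A) : Prop :=
  ∃ (x : Matrix (Fin P.size) (Fin Q.size) B) (y : Matrix (Fin Q.size) (Fin P.size) B),
    IsRightInvariant A P.rep Q.rep x ∧ IsRightInvariant A Q.rep P.rep y ∧
      x * y = P.mat ∧ y * x = Q.mat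

/-- Invariant Murray-von Neumann equivalence. -/
def LeftInvariantProjection.Equiv {A : LeftModuleAlgebra U B}
    (P Q : LeftInvariantProjection A) : Prop :=
  ∃ (x : Matrix (Fin P.size) (Fin Q.size) B) (y : Matrix (Fin Q.size) (Fin P.size) B),
    IsLeftInvariant A P.rep Q.rep x ∧ IsLeftInvariant A Q.rep P.rep y ∧
      x * y = P.mat ∧ y * x = Q.mat

/-- `T` is the block diagonal sum `P ⊕ Q`, with block diagonal anti-representation. -/
def RightInvariantProjection.IsDirectSum {A : RightModuleAlgebra U B}
    (T P Q : RightInvariantProjection A) : Prop :=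
  ∃ e : Fin P.size ⊕ Fin Q.size ≃ Fin T.size,
    T.mat.submatrix e e = Matrix.fromBlocks P.mat 0 0 Q.mat ∧
      ∀ X, (T.rep X).submatrix e e = Matrix.fromBlocks (P.rep X) 0 0 (Q.rep X)

/-- `T` is the block diagonal sum `P ⊕ Q`, with block diagonal anti-representation. -/
def LeftInvariantProjection.IsDirectSum {A : LeftModuleAlgebra U B}
    (T P Q : LeftInvariantProjection A) : Prop :=
  ∃ e : Fin P.size ⊕ Fin Q.size ≃ Fin T.size,
    T.mat.submatrix e e = Matrix.fromBlocks P.mat 0 0 Q.mat ∧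
      ∀ X, (T.rep X).submatrix e e = Matrix.fromBlocks (P.rep X) 0 0 (Q.rep X)

/-- The equivariant `K₀`-group `ᵁK₀(B)` of a right `U`-module algebra: the Grothendieck group of
equivalence classes of right invariant projections under direct sum. It is presented by one
generator `[P]` for each projection and the relations `[P] = [Q]` for equivalent projections and
`[P ⊕ Q] = [P] + [Q]`. -/
def RightK0 (A : RightModuleAlgebra U B) : Type _ :=
  FreeAbelianGroup (RightInvariantProjection A) ⧸ AddSubgroup.closure
    ({x | ∃ P Q : RightInvariantProjection A, P.Equiv Q ∧ x = .of P - .of Q} ∪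
      {x | ∃ T P Q : RightInvariantProjection A, T.IsDirectSum P Q ∧ x = .of T - (.of P + .of Q)})

/-- The equivariant `K₀`-group `K₀(B)ᵁ` of a left `U`-module algebra: the Grothendieck group of
equivalence classes of left invariant projections under direct sum, presented as in the right
case. -/
def LeftK0 (A : LeftModuleAlgebra U B) : Type _ :=
  FreeAbelianGroup (LeftInvariantProjection A) ⧸ AddSubgroup.closure
    ({x | ∃ P Q : LeftInvariantProjection A, P.Equiv Q ∧ x = .of P - .of Q} ∪
      {x | ∃ T P Q : LeftInvariantProjection A, T.IsDirectSum P Q ∧ x = .of T - (.of P + .of Q)})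

instance (A : RightModuleAlgebra U B) : AddCommGroup (RightK0 A) :=
  inferInstanceAs (AddCommGroup (_ ⧸ _))

instance (A : LeftModuleAlgebra U B) : AddCommGroup (LeftK0 A) :=
  inferInstanceAs (AddCommGroup (_ ⧸ _))

/-- The class `[P]` of an invariant projection. -/
def RightK0.of {A : RightModuleAlgebra U B} (P : RightInvariantProjection A) : RightK0 A :=
  QuotientAddGroup.mk (FreeAbelianGroup.of P)

/-- The class `[P]` of an invariant projection. -/
def LeftK0.of {A : LeftModuleAlgebra U B} (P : LeftInvariantProjection A) : LeftK0 A :=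
  QuotientAddGroup.mk (FreeAbelianGroup.of P)

/-- `x` is the class in `ᵁK₀(B)` of the matrix `M` with anti-representation `ρ`; in particular `M`
is a right invariant projection. -/
def RightK0.IsClassOf {A : RightModuleAlgebra U B} (x : RightK0 A)
    (ρ : Uᵐᵒᵖ →ₐ[ℂ] Matrix (Fin N) (Fin N) ℂ) (M : Matrix (Fin N) (Fin N) B) : Prop :=
  ∃ (hM : IsIdempotentElem M) (hρ : IsRightInvariant A ρ ρ M),
    x = RightK0.of ⟨N, ρ, M, hM, hρ⟩

/-- `x` is the class in `K₀(B)ᵁ` of the matrix `M` with anti-representation `ρ`; in particular `M`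
is a left invariant projection. -/
def LeftK0.IsClassOf {A : LeftModuleAlgebra U B} (x : LeftK0 A)
    (ρ : Uᵐᵒᵖ →ₐ[ℂ] Matrix (Fin N) (Fin N) ℂ) (M : Matrix (Fin N) (Fin N) B) : Prop :=
  ∃ (hM : IsIdempotentElem M) (hρ : IsLeftInvariant A ρ ρ M),
    x = LeftK0.of ⟨N, ρ, M, hM, hρ⟩

end Invariant

namespace Datum

variable {ι : Type*} {D : Datum ι}

/-! ### `ℂ_q[G]` as a module algebra, and the matrix units -/

variable (D) in
/-- The right action `◁` of `U_q(𝔤)` on `ℂ_q[G]`. -/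
def rightModuleAlgebra : RightModuleAlgebra D.Uq D.CqG where
  act := LinearMap.mk₂ ℂ (fun X φ => ⟨rightActDual X φ.1, rightActDual_mem X φ.1 φ.2⟩)
    (fun _ _ _ => Subtype.ext (by simp)) (fun _ _ _ => Subtype.ext (by simp))
    (fun _ _ _ => Subtype.ext (by simp)) (fun _ _ _ => Subtype.ext (by simp))
  act_one φ := Subtype.ext (by ext Y; simp)
  act_mul X Y φ := Subtype.ext (by ext Z; simp [mul_assoc])
  act_unit X := Subtype.ext (by ext Y; simp)
  act_prod X a b := Subtype.ext (by
    ext Y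
    change LinearMap.mul' ℂ ℂ (TensorProduct.map a.1.ofConv b.1.ofConv (comulHom (X * Y))) = _
    rw [comul_eq, map_mul]
    generalize comulHom X = t
    induction t using TensorProduct.induction_on with
    | zero => simp
    | add x y hx hy => simp only [add_mul, map_add, hx, hy]; rfl
    | tmul x y =>
      change _ = LinearMap.mul' ℂ ℂ (TensorProduct.map (rightActDual x a.1).ofConv
        (rightActDual y b.1).ofConv (comulHom Y))
      generalize comulHom Y = s
      induction s using TensorProduct.induction_on with
      | zero => simp
      | add x y hx hy => simp only [mul_add, map_add, hx, hy]
      | tmul z w => simp [rightActDual])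

variable (D) in
/-- The left action `▷` of `U_q(𝔤)` on `ℂ_q[G]`. -/
def leftModuleAlgebra : LeftModuleAlgebra D.Uq D.CqG where
  act := LinearMap.mk₂ ℂ (fun X φ => ⟨leftActDual X φ.1, leftActDual_mem X φ.1 φ.2⟩)
    (fun _ _ _ => Subtype.ext (by simp)) (fun _ _ _ => Subtype.ext (by simp))
    (fun _ _ _ => Subtype.ext (by simp)) (fun _ _ _ => Subtype.ext (by simp))
  act_one φ := Subtype.ext (by ext Y; simp)
  act_mul X Y φ := Subtype.ext (by ext Z; simp [mul_assoc])
  act_unit X := Subtype.ext (by ext Y; simp [mul_comm])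
  act_prod X a b := Subtype.ext (by
    ext Y
    change LinearMap.mul' ℂ ℂ (TensorProduct.map a.1.ofConv b.1.ofConv (comulHom (Y * X))) = _
    rw [comul_eq, map_mul]
    generalize comulHom X = t
    induction t using TensorProduct.induction_on with
    | zero => simp
    | add x y hx hy => simp only [mul_add, map_add, hx, hy]; rfl
    | tmul x y =>
      change _ = LinearMap.mul' ℂ ℂ (TensorProduct.map (leftActDual x a.1).ofConv
        (leftActDual y b.1).ofConv (comulHom Y))
      generalize comulHom Y = s
      induction s using TensorProduct.induction_on with
      | zero => simp
      | add x y hx hy => simp only [add_mul, map_add, hx, hy]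
      | tmul z w => simp [leftActDual])

section MatrixUnits

variable {V : Type*} [NormedAddCommGroup V] [InnerProductSpace ℂ V] [FiniteDimensional ℂ V]

/-- Unitarity with respect to the compact real form. -/
def IsUnitary (π : D.Uq →ₐ[ℂ] Module.End ℂ V) : Prop :=
  ∀ (X : D.Uq) (v w : V), ⟪π X v, w⟫_ℂ = ⟪v, π (starU X) w⟫_ℂ

variable {N : ℕ} {π : D.Uq →ₐ[ℂ] Module.End ℂ V} {Λ : ι → ℕ}

/-- The matrix coefficients `u^i_j(X) = f^i(X ▷ v_j)`. -/
def u (hπ : IsIrreducibleOfHighestWeight π Λ) (v : OrthonormalBasis (Fin N) ℂ V) (i j : Fin N) :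
    D.CqG :=
  ⟨coeff π (v.toBasis.coord i) (v j), coeff_mem hπ.isTypeOne _ _⟩

/-- The matrix unit `M^n_m`, with entries `(M^n_m)^i_j = (u^m_i)* u^n_j`. -/
def matM (hπ : IsIrreducibleOfHighestWeight π Λ) (v : OrthonormalBasis (Fin N) ℂ V)
    (n m : Fin N) : Matrix (Fin N) (Fin N) D.CqG :=
  .of fun i j => CqG.star (u hπ v m i) * u hπ v n j

/-- The matrix unit `N^n_m`, with entries `(N^n_m)^i_j = u^i_m (u^j_n)*`. -/
def matN (hπ : IsIrreducibleOfHighestWeight π Λ) (v : OrthonormalBasis (Fin N) ℂ V)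
    (n m : Fin N) : Matrix (Fin N) (Fin N) D.CqG :=
  .of fun i j => u hπ v i m * CqG.star (u hπ v j n)

/-- `P = ∑ c^m_n M^n_m`. -/
def matP (hπ : IsIrreducibleOfHighestWeight π Λ) (v : OrthonormalBasis (Fin N) ℂ V)
    (c : Fin N → Fin N → ℂ) : Matrix (Fin N) (Fin N) D.CqG :=
  ∑ m, ∑ n, c m n • matM hπ v n m

/-- `Q = ∑ c^m_n N^n_m`. -/
def matQ (hπ : IsIrreducibleOfHighestWeight π Λ) (v : OrthonormalBasis (Fin N) ℂ V)
    (c : Fin N → Fin N → ℂ) : Matrix (Fin N) (Fin N) D.CqG :=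
  ∑ m, ∑ n, c m n • matN hπ v n m

/-- The matrix of `π(X)` in the basis `v`: `X ▷ v_i = ∑_j π(X)^j_i v_j`. -/
def repMatrix (π : D.Uq →ₐ[ℂ] Module.End ℂ V) (v : OrthonormalBasis (Fin N) ℂ V) (X : D.Uq) :
    Matrix (Fin N) (Fin N) ℂ :=
  LinearMap.toMatrix v.toBasis v.toBasis (π X)

end MatrixUnits

end Datum

/-! ### The data of a simple Lie algebra -/

section LieData

variable {ι M N : Type*} [Fintype ι] [AddCommGroup M] [Module ℂ M] [AddCommGroup N] [Module ℂ N]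
  {P : RootPairing ι ℂ M N} [P.IsCrystallographic]

variable (P) in
/-- `(α, α) / 2` for the invariant form normalized so that short roots satisfy `(α, α) = 2`, that
is, the squared length of `α` divided by the squared length of a shortest root. (For an irreducible
root system the invariant form is unique up to scaling; we scale Mathlib's canonical one.) -/
def halfSqLength (i : ι) : ℝ :=
  ((P.posRootForm ℤ).rootLength i : ℝ) / ⨅ j, ((P.posRootForm ℤ).rootLength j : ℝ)

theorem halfSqLength_pos (i : ι) : 0 < halfSqLength P i := by
  have : Nonempty ι := ⟨i⟩
  obtain ⟨j, hj⟩ := exists_eq_ciInf_of_finite (f := fun j => ((P.posRootForm ℤ).rootLength j : ℝ))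
  unfold halfSqLength
  rw [← hj]
  exact div_pos (Int.cast_pos.2 ((P.posRootForm ℤ).rootLength_pos i))
    (Int.cast_pos.2 ((P.posRootForm ℤ).rootLength_pos j))

/-- The Cartan matrix `a_ij = 2 (α_i, α_j) / (α_i, α_i)` (the transpose of Mathlib's convention)
and the numbers `d_i = (α_i, α_i) / 2` attached to a base of a root system. -/
def Datum.ofBase (b : P.Base) (q : ℝ) (hq0 : 0 < q) (hq1 : q ≠ 1) : Datum b.support where
  a i j := b.cartanMatrix j i
  d i := halfSqLength P i
  q := q
  a_diag i := b.cartanMatrix_apply_same i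
  a_nonpos i j h := b.cartanMatrix_le_zero_of_ne j i h.symm
  d_pos i := halfSqLength_pos _
  symm i j := by
    have := (P.posRootForm ℤ).pairingIn_mul_eq_pairingIn_mul_swap (i : ι) (j : ι)
    have h2 : ((b.cartanMatrix j i : ℤ) : ℝ) * ((P.posRootForm ℤ).rootLength i : ℝ) =
        ((b.cartanMatrix i j : ℤ) : ℝ) * ((P.posRootForm ℤ).rootLength j : ℝ) := by
      exact_mod_cast this
    unfold halfSqLength
    rw [div_mul_eq_mul_div, div_mul_eq_mul_div, mul_comm, h2, mul_comm]
  q_pos := hq0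
  q_ne_one := hq1

open scoped Classical in
/-- The coefficients `n_i` of `2ρ = ∑_{α > 0} α = ∑ n_i α_i`. -/
def twoRho (b : P.Base) (i : b.support) : ℤ :=
  ∑ β : ι, if b.IsPos β then b.toWeightBasisInt.repr (P.rootSpanMem ℤ β) i else 0

end LieData

end QuantumGroup

end

/-! Write `τ` for `π` in matrix form, so that `u^i_j(X) = τ(X)_{ij}`. Unitarity turns the star into
the antipode: `(u^i_j)*(X) = τ(S(X))_{ji}` (`star_u_apply`). Since the action on a product is
distributed by the coproduct, acting entrywise on a matrix unit amounts to multiplying it by scalar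
matrices on both sides: `X ▷ M = τ(S(X₍₁₎)) M τ(X₍₂₎)` and `N ◁ X = τ(X₍₁₎) N τ(S(X₍₂₎))`
(`entrywise_leftAct_matM`, `entrywise_rightAct_matN`). The indices `m`, `n` play no part in this.

In the convolution algebra of linear maps from `U` to matrices, `τ ∘ S` is the two-sided inverse of
`τ`. For the right action take `ρ° = τ ∘ S`. The invariance expression becomes `τ(S(X₍₁₎)) τ(X₍₂₎) N
τ(S(X₍₃₎)) τ(X₍₄₎)`, and the factors on each side of `N` collapse, leaving `ε(X) N`
(`matConv_conj_eq_counit_smul`). For the left action the definition of invariance inserts `S⁻²`, a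
Hopf algebra automorphism, so `τ` has to be replaced throughout by `τ' = τ ∘ S⁻²`, and `ρ° = τ' ∘ S`
works by the same cancellation.

The element `K_{2ρ}` enters only through `S²(X) = K_{2ρ} X K_{2ρ}⁻¹` (`antipode_sq_mul_Klam`). It
gives `τ'(X) = τ(K_{2ρ}⁻¹ X K_{2ρ})` on the left and `S(X) = K_{2ρ} S⁻¹(X) K_{2ρ}⁻¹` on the right,
which are the asserted forms of `ρ°`. The formula for `S²` is checked on generators and rests on the
fact that `2ρ` pairs to `2` with every simple coroot (`sum_twoRho_mul_cartanMatrix`).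

Finally, invariance is linear in the matrix, so it passes from the matrix units to their
combinations; an idempotent combination then has a class in `K₀`. -/

namespace QuantumGroup

/-! ### The sum of the positive roots against simple coroots. -/

section RootSystem

variable {ι R M N : Type*} [Fintype ι] [CommRing R] [IsDomain R] [CharZero R]
  [AddCommGroup M] [Module R M] [AddCommGroup N] [Module R N]
  {P : RootPairing ι R M N} [P.IsCrystallographic] [P.IsReduced]

open scoped Classical in
/-- The sum of the positive roots pairs to `2` with every simple coroot. -/
theorem sum_isPos_pairingIn (b : P.Base) {j : ι} (hj : j ∈ b.support) :
    ∑ β : ι, (if b.IsPos β then P.pairingIn ℤ β j else 0) = 2 := by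
  -- The simple root itself contributes `2`. The simple reflection is an involution on the other
  -- positive roots and negates the pairing with the coroot, so the remaining terms cancel in pairs.
  rw [← Finset.sum_filter,
    ← Finset.add_sum_erase _ _ (Finset.mem_filter.2 ⟨Finset.mem_univ j, b.isPos_of_mem_support hj⟩),
    Finset.sum_involution (fun β _ => P.reflectionPerm j β), add_zero, P.pairingIn_same ℤ]
  · intro β _
    rw [← P.pairingIn_reflectionPerm, P.pairingIn_reflectionPerm_self_right, add_neg_cancel]
  -- A root fixed by the reflection has a pairing equal to its own negative, so its term is zero.
  · intro β _ h0 h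
    have h1 := P.pairingIn_reflectionPerm ℤ j β j
    rw [h, P.pairingIn_reflectionPerm_self_right] at h1
    exact h0 (by omega)
  · intro β hβ
    simp only [Finset.mem_erase, Finset.mem_filter, Finset.mem_univ, true_and] at hβ ⊢
    -- The image is positive because a simple reflection makes no positive root negative except the
    -- simple root itself. If the image were that simple root, `β` would be its negative, which has
    -- negative height.
    refine ⟨fun h => ?_, hβ.2.reflectionPerm hj hβ.1⟩
    have h1 : β = P.reflectionPerm j j := by
      rw [← P.reflectionPerm_self j β, h]
    have h2 := b.height_reflectionPerm_self j
    have h3 := b.isPos_of_mem_support hj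
    have h4 := hβ.2
    rw [RootPairing.Base.isPos_iff] at h3 h4
    rw [h1] at h4
    change b.height (P.reflectionPerm j j) = _ at h2
    omega
  · intro β _
    exact P.reflectionPerm_self j β

end RootSystem

/-- Pairing with a coroot is additive: expanding each positive root in the simple roots and
exchanging the two sums reduces this to `sum_isPos_pairingIn`. This is all that is needed about the
coefficients of `2ρ`. -/
theorem sum_twoRho_mul_cartanMatrix {ι M N : Type*} [Fintype ι] [AddCommGroup M] [Module ℂ M]
    [AddCommGroup N] [Module ℂ N] {P : RootPairing ι ℂ M N} [P.IsCrystallographic] [P.IsReduced]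
    (b : P.Base) (j : b.support) : ∑ i, twoRho b i * b.cartanMatrix i j = 2 := by
  classical
  rw [← sum_isPos_pairingIn b j.2]
  simp only [twoRho, Finset.sum_mul]
  rw [Finset.sum_comm]
  refine Finset.sum_congr rfl fun β _ => ?_
  split_ifs
  -- The coroot functional is applied to the expansion of `β` in the basis of simple roots.
  · have hβ := congrArg (P.coroot'In ℤ j) (b.toWeightBasisInt.sum_repr (P.rootSpanMem ℤ β))
    rw [P.coroot'In_rootSpanMem_eq_pairingIn, map_sum] at hβ
    rw [← hβ]
    refine Finset.sum_congr rfl fun i _ => ?_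
    have h : b.toWeightBasisInt i = P.rootSpanMem ℤ i :=
      Subtype.ext (b.coe_toWeightBasisInt_apply i)
    rw [map_smul, h, P.coroot'In_rootSpanMem_eq_pairingIn, smul_eq_mul]
    rfl
  · simp

/-! ### The square of the antipode. -/

namespace Datum

variable {ι : Type*} {D : Datum ι}

/-- The hypothesis says that `x` intertwines `c K_i` with `K_i`. Intertwining relations between
units pass to all integer powers, negative ones included, and the central scalar `c` then separates
from the power of `K_i`. -/
theorem unitK_zpow_mul {i : ι} {x : D.Uq} {c : ℂ} (hc : c ≠ 0) (h : D.K i * x = c • (x * D.K i))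
    (n : ℤ) : ((D.unitK i ^ n : D.Uqˣ) : D.Uq) * x =
      c ^ n • (x * ((D.unitK i ^ n : D.Uqˣ) : D.Uq)) := by
  -- The scalar is made a unit of the algebra so that `c K_i` can be raised to negative powers.
  set z : D.Uqˣ := Units.map (algebraMap ℂ D.Uq).toMonoidHom (Units.mk0 c hc) with hz
  have hzn (m : ℤ) : ((z ^ m : D.Uqˣ) : D.Uq) = algebraMap ℂ D.Uq (c ^ m) := by
    rw [hz, ← map_zpow, Units.coe_map, Units.val_zpow_eq_zpow_val]
    rfl
  have hs : SemiconjBy x ((z * D.unitK i : D.Uqˣ) : D.Uq) (D.unitK i : D.Uqˣ) := by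
    change x * (algebraMap ℂ D.Uq c * D.K i) = D.K i * x
    rw [← Algebra.smul_def, mul_smul_comm, h]
  have hcomm : Commute z (D.unitK i) := Units.ext (Algebra.commutes c (D.K i))
  rw [← (hs.units_zpow_right n).eq, hcomm.mul_zpow, Units.val_mul, hzn, ← Algebra.smul_def,
    mul_smul_comm]

theorem Klam_mul [Fintype ι] {x : D.Uq} {c : ι → ℂ} (hc : ∀ i, c i ≠ 0)
    (h : ∀ i, D.K i * x = c i • (x * D.K i)) (n : ι → ℤ) :
    (D.Klam n : D.Uq) * x = (∏ i, c i ^ n i) • (x * (D.Klam n : D.Uq)) := by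
  classical
  unfold Klam
  -- The commutativity proof inside the product depends on the index set, so it has to vary along
  -- with that set in the induction.
  generalize_proofs hcomm
  revert hcomm
  refine Finset.induction_on Finset.univ (by simp) ?_
  intro i s his ih hcomm
  rw [Finset.noncommProd_insert_of_notMem _ _ _ _ his, Finset.prod_insert his, Units.val_mul,
    mul_assoc, ih, mul_smul_comm, ← mul_assoc, unitK_zpow_mul (hc i) (h i), smul_mul_assoc,
    smul_smul, mul_comm (c i ^ n i), mul_assoc]

/-- By the symmetry `q_i ^ a_ij = q_j ^ a_ji` all factors become powers of the single base `q_j`,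
whose exponents add up. The integer `s` is a sign: `1` serves for `E_j` and `-1` for `F_j`. -/
theorem prod_qi_zpow [Fintype ι] {n : ι → ℤ} {j : ι} (hn : ∑ i, n i * D.a j i = 2) (s : ℤ) :
    ∏ i, (D.qi i ^ (s * D.a i j)) ^ n i = D.qi j ^ (s * 2) := by
  rw [← hn, Finset.mul_sum]
  have : ∀ t : Finset ι, D.qi j ^ (∑ i ∈ t, s * (n i * D.a j i)) =
      ∏ i ∈ t, D.qi j ^ (s * (n i * D.a j i)) := by
    classical
    intro t
    induction t using Finset.induction_on with
    | empty => simp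
    | insert i t hi ih =>
      rw [Finset.sum_insert hi, Finset.prod_insert hi, zpow_add₀ (D.qi_ne_zero j), ih]
  rw [this]
  refine Finset.prod_congr rfl fun i _ => ?_
  rw [mul_comm s, zpow_mul, D.qi_symm, ← zpow_mul, ← zpow_mul]
  congr 1
  ring

/-- The square of the antipode is conjugation by `K_{2ρ}`. -/
theorem antipode_sq_mul_Klam [Fintype ι] {n : ι → ℤ} (hn : ∀ j, ∑ i, n i * D.a j i = 2)
    (X : D.Uq) : antipodeLin (antipodeLin X) * D.Klam n = D.Klam n * X := by
  have hr := D.relations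
  -- `E_j` has weight `α_j`, so passing `K_{2ρ}` across it costs `q ^ (2ρ, α_j)`, which is `q_j ^
  -- 2`.
  have hE (j : ι) : (D.Klam n : D.Uq) * D.E j = (D.qi j ^ (2 : ℤ)) • (D.E j * D.Klam n) := by
    rw [Klam_mul (fun i => zpow_ne_zero (D.a i j) (D.qi_ne_zero i)) (fun i => hr.k_e i j)]
    simpa using congrArg (· • (D.E j * (D.Klam n : D.Uq))) (prod_qi_zpow (hn j) 1)
  have hF (j : ι) : (D.Klam n : D.Uq) * D.F j = (D.qi j ^ (-2 : ℤ)) • (D.F j * D.Klam n) := by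
    rw [Klam_mul (fun i => zpow_ne_zero (-D.a i j) (D.qi_ne_zero i)) (fun i => hr.k_f i j)]
    simpa using congrArg (· • (D.F j * (D.Klam n : D.Uq))) (prod_qi_zpow (hn j) (-1))
  have hK (j : ι) : (D.Klam n : D.Uq) * D.K j = D.K j * D.Klam n := by
    rw [Klam_mul (c := fun _ => 1) (fun _ => one_ne_zero)
      (fun i => by rw [one_smul, hr.comm])]
    simp
  have hK' (j : ι) : (D.Klam n : D.Uq) * D.K' j = D.K' j * D.Klam n := by
    rw [Klam_mul (c := fun _ => 1) (fun _ => one_ne_zero)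
      (fun i => by rw [one_smul, hr.k'_k])]
    simp
  -- Since `S²` is multiplicative, the induction hypothesis carries `K_{2ρ}` past the tail of a word
  -- and only the leading generator has to be compared.
  induction X using induction_gen with
  | h1 => simp
  | hE i x ih =>
    rw [antipodeLin_mul, antipodeLin_mul, mul_assoc, ih, ← mul_assoc, ← mul_assoc, hE]
    congr 1
    -- Here `S²(E_i) = K_i E_i K_i⁻¹`, and `a_ii = 2` makes this the same factor `q_i ^ 2`.
    simp only [antipodeLin_E, map_neg, antipodeLin_mul, antipodeLin_K', mul_neg, neg_neg]
    rw [← mul_assoc, hr.k_e, D.a_diag, smul_mul_assoc, mul_assoc (D.E i), hr.kk', mul_one,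
      smul_mul_assoc]
  | hF i x ih =>
    rw [antipodeLin_mul, antipodeLin_mul, mul_assoc, ih, ← mul_assoc, ← mul_assoc, hF]
    congr 1
    simp only [antipodeLin_F, map_neg, antipodeLin_mul, antipodeLin_K, neg_mul, neg_neg]
    rw [hr.kf, D.a_diag, smul_mul_assoc]
  | hK i x ih =>
    rw [antipodeLin_mul, antipodeLin_mul, mul_assoc, ih, ← mul_assoc, ← mul_assoc, hK]
    simp
  | hK' i x ih =>
    rw [antipodeLin_mul, antipodeLin_mul, mul_assoc, ih, ← mul_assoc, ← mul_assoc, hK']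
    simp
  | hadd x y hx hy => simp only [map_add, add_mul, mul_add, hx, hy]
  | hsmul c x hx => simp only [map_smul, smul_mul_assoc, mul_smul_comm, hx]

end Datum

end QuantumGroup

namespace QuantumGroup

/-! ### Convolution of matrix-valued maps. -/

section Convolution

variable {U B : Type*} [Ring U] [HopfAlgebra ℂ U] [Ring B] [Algebra ℂ B] {N : ℕ}

/-- Identifying the two products makes associativity of convolution, and its unit `X ↦ ε(X) 1`,
available for iterated Sweedler expressions in square matrices. -/
theorem matConv_eq_convMul (f g : U →ₗ[ℂ] Matrix (Fin N) (Fin N) B) :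
    matConv f g = (WithConv.toConv f * WithConv.toConv g).ofConv := by
  ext1 X
  change TensorProduct.lift (matMul.compl₁₂ f g) (Coalgebra.comul X) =
    LinearMap.mul' ℂ (Matrix (Fin N) (Fin N) B) (TensorProduct.map f g (Coalgebra.comul X))
  generalize Coalgebra.comul (R := ℂ) X = t
  induction t using TensorProduct.induction_on with
  | zero => simp
  | add x y hx hy => simp only [map_add, hx, hy]
  | tmul x y => simp [matMul]

/-- Conjugating `M` by convolution-inverse matrix-valued maps on both sides returns `ε(X) M`. -/
theorem matConv_conj_eq_counit_smul {f₁ f₂ g₁ g₂ : U →ₗ[ℂ] Matrix (Fin N) (Fin N) B}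
    (h₁ : WithConv.toConv f₁ * WithConv.toConv g₁ = 1)
    (h₂ : WithConv.toConv g₂ * WithConv.toConv f₂ = 1) (M : Matrix (Fin N) (Fin N) B) (X : U) :
    matConv (matConv f₁ (matConv g₁ (LinearMap.mulLeft ℂ M ∘ₗ g₂))) f₂ X =
      Coalgebra.counit (R := ℂ) X • M := by
  -- A constant matrix on the far left comes out of a convolution by associativity of matrix
  -- multiplication alone.
  have hmul (f g : U →ₗ[ℂ] Matrix (Fin N) (Fin N) B) :
      WithConv.toConv (LinearMap.mulLeft ℂ M ∘ₗ f) * WithConv.toConv g =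
        WithConv.toConv (LinearMap.mulLeft ℂ M ∘ₗ
          (WithConv.toConv f * WithConv.toConv g).ofConv) := by
    refine WithConv.ofConv_injective (LinearMap.ext fun X => ?_)
    change LinearMap.mul' ℂ (Matrix (Fin N) (Fin N) B)
        (TensorProduct.map (LinearMap.mulLeft ℂ M ∘ₗ f) g (Coalgebra.comul X)) =
      M * LinearMap.mul' ℂ (Matrix (Fin N) (Fin N) B) (TensorProduct.map f g (Coalgebra.comul X))
    generalize Coalgebra.comul (R := ℂ) X = t
    induction t using TensorProduct.induction_on with
    | zero => simp
    | add x y hx hy => simp only [map_add, mul_add, hx, hy]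
    | tmul x y => simp [mul_assoc]
  simp only [matConv_eq_convMul, WithConv.toConv_ofConv]
  -- Regrouping cancels the two factors to the left of `M` first, and then, with `M` pulled out, the
  -- two to its right.
  rw [← mul_assoc, h₁, one_mul, hmul, h₂]
  change M * algebraMap ℂ (Matrix (Fin N) (Fin N) B) (Coalgebra.counit (R := ℂ) X) = _
  rw [← Algebra.commutes, Algebra.smul_def]

/-- A map compatible with the coproduct can be substituted into both legs of a convolution. It will
be used for `S⁻²`. -/
theorem matConv_comp {l m n : Type*} [Fintype l] [Fintype m] [Fintype n]
    (f : U →ₗ[ℂ] Matrix l m B) (g : U →ₗ[ℂ] Matrix m n B) (φ : U →ₐ[ℂ] U)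
    (hφ : ∀ X, Coalgebra.comul (R := ℂ) (φ X) =
      TensorProduct.map φ.toLinearMap φ.toLinearMap (Coalgebra.comul (R := ℂ) X)) :
    matConv f g ∘ₗ φ.toLinearMap = matConv (f ∘ₗ φ.toLinearMap) (g ∘ₗ φ.toLinearMap) := by
  ext1 X
  change TensorProduct.lift (matMul.compl₁₂ f g) (Coalgebra.comul (φ X)) =
    TensorProduct.lift (matMul.compl₁₂ (f ∘ₗ φ.toLinearMap) (g ∘ₗ φ.toLinearMap))
      (Coalgebra.comul X)
  rw [hφ]
  generalize Coalgebra.comul (R := ℂ) X = t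
  induction t using TensorProduct.induction_on with
  | zero => simp
  | add x y hx hy => simp only [map_add, hx, hy]
  | tmul x y => simp

theorem scalarMat_comp {l m : Type*} (ρ : U →ₗ[ℂ] Matrix l m ℂ) (φ : U →ₗ[ℂ] U) :
    scalarMat B ρ ∘ₗ φ = scalarMat B (ρ ∘ₗ φ) := rfl

theorem entrywise_comp {l m : Type*} (T : U →ₗ[ℂ] B →ₗ[ℂ] B) (M : Matrix l m B) (φ : U →ₗ[ℂ] U) :
    entrywise T M ∘ₗ φ = entrywise (T ∘ₗ φ) M := rfl

/-- Composing with an algebra map distributes over convolution. Identities between `id` and `S` in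
the convolution algebra of `U` thus transfer to `τ` and `τ ∘ S`. -/
theorem toConv_scalarMat_mul (τ : U →ₐ[ℂ] Matrix (Fin N) (Fin N) ℂ) (a b : U →ₗ[ℂ] U) :
    WithConv.toConv (scalarMat B (τ.toLinearMap ∘ₗ a)) *
        WithConv.toConv (scalarMat B (τ.toLinearMap ∘ₗ b)) =
      WithConv.toConv (scalarMat B
        (τ.toLinearMap ∘ₗ (WithConv.toConv a * WithConv.toConv b).ofConv)) := by
  -- Including scalar matrices into matrices over `B` is an algebra map, so its composite with `τ`
  -- is one as well.
  have h (f : U →ₗ[ℂ] U) : scalarMat B (τ.toLinearMap ∘ₗ f) =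
      ((Algebra.ofId ℂ B).mapMatrix.comp τ).toLinearMap ∘ₗ f := rfl
  simp only [h]
  rw [LinearMap.algHom_comp_convMul_distrib]

theorem scalarMat_comp_one (τ : U →ₐ[ℂ] Matrix (Fin N) (Fin N) ℂ) :
    WithConv.toConv (scalarMat B (τ.toLinearMap ∘ₗ (1 : WithConv (U →ₗ[ℂ] U)).ofConv)) = 1 := by
  refine WithConv.ofConv_injective (LinearMap.ext fun X => ?_)
  change (Algebra.ofId ℂ B).mapMatrix (τ (algebraMap ℂ U (Coalgebra.counit (R := ℂ) X))) =
    algebraMap ℂ (Matrix (Fin N) (Fin N) B) (Coalgebra.counit (R := ℂ) X)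
  rw [AlgHom.commutes, AlgHom.commutes]

/-- The antipode axiom, pushed forward along `τ`. Together with its mirror image below it makes `τ ∘
S` the convolution inverse of `τ`. -/
theorem scalarMat_id_mul_antipode (τ : U →ₐ[ℂ] Matrix (Fin N) (Fin N) ℂ) :
    WithConv.toConv (scalarMat B τ.toLinearMap) *
      WithConv.toConv (scalarMat B (τ.toLinearMap ∘ₗ HopfAlgebra.antipode ℂ)) = 1 := by
  rw [← LinearMap.comp_id τ.toLinearMap, LinearMap.comp_assoc, LinearMap.id_comp,
    toConv_scalarMat_mul, LinearMap.id_mul_antipode, scalarMat_comp_one]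

theorem scalarMat_antipode_mul_id (τ : U →ₐ[ℂ] Matrix (Fin N) (Fin N) ℂ) :
    WithConv.toConv (scalarMat B (τ.toLinearMap ∘ₗ HopfAlgebra.antipode ℂ)) *
      WithConv.toConv (scalarMat B τ.toLinearMap) = 1 := by
  rw [← LinearMap.comp_id τ.toLinearMap, LinearMap.comp_assoc, LinearMap.id_comp,
    toConv_scalarMat_mul, LinearMap.antipode_mul_id, scalarMat_comp_one]

end Convolution

/-! ### The automorphism `S⁻²` as a coalgebra map. -/

namespace Datum

variable {ι : Type*} {D : Datum ι}

variable (D) in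
/-- The inverse of the square of the antipode, as an algebra automorphism. -/
noncomputable def antipodeInvSq : D.Uq →ₐ[ℂ] D.Uq :=
  AlgHom.ofLinearMap (antipodeInvLin ∘ₗ antipodeInvLin) (by simp)
    (fun X Y => by simp [antipodeInvLin_mul])

theorem antipodeInvSq_apply (X : D.Uq) :
    D.antipodeInvSq X = antipodeInvLin (antipodeInvLin X) := rfl

/-- Both sides are algebra maps in `X`, so generators suffice: there `S⁻²` fixes `K_i` and sends
`E_i` and `F_i` to their conjugates `K_i⁻¹ E_i K_i` and `K_i⁻¹ F_i K_i`. -/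
theorem comul_antipodeInvSq (X : D.Uq) :
    Coalgebra.comul (R := ℂ) (D.antipodeInvSq X) =
      TensorProduct.map D.antipodeInvSq.toLinearMap D.antipodeInvSq.toLinearMap
        (Coalgebra.comul (R := ℂ) X) := by
  have h : comulHom.comp D.antipodeInvSq =
      (Algebra.TensorProduct.map D.antipodeInvSq D.antipodeInvSq).comp comulHom := by
    have hr := D.relations
    have hcancel (i : ι) (x : D.Uq) : D.K' i * (D.K i * x) = x := by
      rw [← mul_assoc, hr.k'k, one_mul]
    apply algHom_ext <;> intro i <;>
      simp [antipodeInvSq_apply, comulHom, antipodeInvLin_mul, mul_add, add_mul,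
        hr.k'k, hcancel, mul_assoc]
  exact DFunLike.congr_fun h X

/-! ### Covariance and invariance of the matrix units. -/

section MatrixUnits

variable {V : Type*} [NormedAddCommGroup V] [InnerProductSpace ℂ V]
  {N : ℕ} {π : D.Uq →ₐ[ℂ] Module.End ℂ V} {Λ : ι → ℕ}

/-- The representation `π` as an algebra map to matrices. -/
noncomputable def repMatrixHom (π : D.Uq →ₐ[ℂ] Module.End ℂ V) (v : OrthonormalBasis (Fin N) ℂ V) :
    D.Uq →ₐ[ℂ] Matrix (Fin N) (Fin N) ℂ :=
  (LinearMap.toMatrixAlgEquiv v.toBasis).toAlgHom.comp π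

theorem repMatrixHom_apply (π : D.Uq →ₐ[ℂ] Module.End ℂ V) (v : OrthonormalBasis (Fin N) ℂ V)
    (X : D.Uq) : repMatrixHom π v X = repMatrix π v X := rfl

theorem repMatrixHom_apply_apply (π : D.Uq →ₐ[ℂ] Module.End ℂ V)
    (v : OrthonormalBasis (Fin N) ℂ V) (X : D.Uq) (i j : Fin N) :
    repMatrixHom π v X i j = v.toBasis.coord i (π X (v j)) := by
  simp [repMatrixHom_apply, repMatrix, LinearMap.toMatrix_apply]

/-- `X ↦ π(K⁻¹ X K)` in matrix form. -/
noncomputable def conjRepMatrixHom (π : D.Uq →ₐ[ℂ] Module.End ℂ V)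
    (v : OrthonormalBasis (Fin N) ℂ V) (K : D.Uqˣ) : D.Uq →ₐ[ℂ] Matrix (Fin N) (Fin N) ℂ :=
  AlgHom.ofLinearMap ((repMatrixHom π v).toLinearMap ∘ₗ LinearMap.mulLeft ℂ (K⁻¹ : D.Uqˣ).val ∘ₗ
      LinearMap.mulRight ℂ K.val)
    (by simp)
    (fun X Y => by
      simp only [LinearMap.comp_apply, AlgHom.toLinearMap_apply, LinearMap.mulLeft_apply,
        LinearMap.mulRight_apply, ← map_mul]
      congr 1
      simp [mul_assoc])

theorem conjRepMatrixHom_apply (K : D.Uqˣ) (X : D.Uq) :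
    conjRepMatrixHom π v K X = repMatrixHom π v ((K⁻¹ : D.Uqˣ) * (X * K)) := rfl

variable [FiniteDimensional ℂ V] (hπ : IsIrreducibleOfHighestWeight π Λ) (v : OrthonormalBasis (Fin N) ℂ V)

theorem u_apply (i j : Fin N) (X : D.Uq) : (u hπ v i j).1 X = repMatrixHom π v X i j := by
  rw [repMatrixHom_apply_apply]
  rfl

/-- In an orthonormal basis matrix entries are inner products. Unitarity moves `S(X)*` to the other
side as `S(X)`, and the complex conjugation exchanges the two slots, whence the transposed indices.
-/
theorem star_u_apply (hu : IsUnitary π) (i j : Fin N) (X : D.Uq) :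
    (CqG.star (u hπ v i j)).1 X = repMatrixHom π v (antipodeLin X) j i := by
  change starRingEnd ℂ ((u hπ v i j).1 (starU (antipodeLin X))) = _
  rw [u_apply, repMatrixHom_apply_apply, repMatrixHom_apply_apply]
  simp only [Module.Basis.coord_apply, OrthonormalBasis.coe_toBasis_repr_apply,
    OrthonormalBasis.repr_apply_apply]
  rw [← hu, inner_conj_symm]

theorem sum_smul_apply {κ : Type*} [Fintype κ] (c : κ → ℂ) (φ : κ → D.CqG) (Y : D.Uq) :
    (∑ k, c k • φ k).1 Y = ∑ k, c k * (φ k).1 Y := by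
  let ev : D.CqG →ₗ[ℂ] ℂ :=
    { toFun := fun φ => φ.1 Y
      map_add' := fun _ _ => rfl
      map_smul' := fun _ _ => rfl }
  change ev _ = ∑ k, c k * ev (φ k)
  simp

theorem CqG_ext {φ ψ : D.CqG} (h : ∀ Y, φ.1 Y = ψ.1 Y) : φ = ψ :=
  Subtype.ext (WithConv.ofConv_injective (LinearMap.ext h))

/-- The matrix of `Y X` is the product of the two matrices, so the left action mixes only the second
index. The first one, which labels the matrix unit, stays fixed. -/
theorem leftAct_u (X : D.Uq) (i j : Fin N) : D.leftModuleAlgebra.act X (u hπ v i j) =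
    ∑ k, repMatrixHom π v X k j • u hπ v i k := by
  refine CqG_ext fun Y => ?_
  change (u hπ v i j).1 (Y * X) = _
  simp only [sum_smul_apply, u_apply, map_mul, Matrix.mul_apply]
  exact Finset.sum_congr rfl fun k _ => mul_comm _ _

/-- Because `S` reverses products and the indices are transposed, the scalar matrix is contracted
from the left here, whereas for `u` it is contracted from the right. This places the two factors on
opposite sides of the matrix unit. -/
theorem leftAct_star_u (hu : IsUnitary π) (X : D.Uq) (i j : Fin N) :
    D.leftModuleAlgebra.act X (CqG.star (u hπ v i j)) =
    ∑ k, repMatrixHom π v (antipodeLin X) j k • CqG.star (u hπ v i k) := by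
  refine CqG_ext fun Y => ?_
  change (CqG.star (u hπ v i j)).1 (Y * X) = _
  simp only [sum_smul_apply, star_u_apply hπ v hu, antipodeLin_mul, map_mul, Matrix.mul_apply]

/-- The mirror image: the right action mixes only the first index. -/
theorem rightAct_u (X : D.Uq) (i j : Fin N) : D.rightModuleAlgebra.act X (u hπ v i j) =
    ∑ k, repMatrixHom π v X i k • u hπ v k j := by
  refine CqG_ext fun Y => ?_
  change (u hπ v i j).1 (X * Y) = _
  simp only [sum_smul_apply, u_apply, map_mul, Matrix.mul_apply]

theorem rightAct_star_u (hu : IsUnitary π) (X : D.Uq) (i j : Fin N) :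
    D.rightModuleAlgebra.act X (CqG.star (u hπ v i j)) =
    ∑ k, repMatrixHom π v (antipodeLin X) k i • CqG.star (u hπ v k j) := by
  refine CqG_ext fun Y => ?_
  change (CqG.star (u hπ v i j)).1 (X * Y) = _
  simp only [sum_smul_apply, star_u_apply hπ v hu, antipodeLin_mul, map_mul, Matrix.mul_apply]
  exact Finset.sum_congr rfl fun k _ => mul_comm _ _

/-- Only the scalars are moved, and they are central; the order of `x` and `y` is kept, so `B` may
be noncommutative. This turns transformation rules for two coefficients into multiplication of their
outer product by scalar matrices. -/
theorem sum_smul_mul_sum_smul {B : Type*} [Ring B] [Algebra ℂ B] (A C : Matrix (Fin N) (Fin N) ℂ)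
    (x y : Fin N → B) (i j : Fin N) :
    (∑ k, A i k • x k) * (∑ l, C l j • y l) = (A.map (algebraMap ℂ B) *
      (Matrix.of (fun k l => x k * y l) * C.map (algebraMap ℂ B))) i j := by
  simp only [Matrix.mul_apply, Matrix.map_apply, Matrix.of_apply, Finset.sum_mul, Finset.mul_sum]
  rw [Finset.sum_comm]
  refine Finset.sum_congr rfl fun k _ => Finset.sum_congr rfl fun l _ => ?_
  rw [← Algebra.commutes (C l j), ← Algebra.smul_def, ← Algebra.smul_def, smul_mul_smul_comm,
    smul_smul]

/-- The module algebra law gives `X₍₁₎` to the starred factor and `X₍₂₎` to the other. The first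
contributes `τ(S(X₍₁₎))` on the left, the second `τ(X₍₂₎)` on the right. -/
theorem entrywise_leftAct_matM (hu : IsUnitary π) (n m : Fin N) :
    entrywise D.leftModuleAlgebra.act (matM hπ v n m) =
      matConv (scalarMat D.CqG ((repMatrixHom π v).toLinearMap ∘ₗ HopfAlgebra.antipode ℂ))
        (LinearMap.mulLeft ℂ (matM hπ v n m) ∘ₗ
          scalarMat D.CqG (repMatrixHom π v).toLinearMap) := by
  ext1 X
  ext1 i j
  change D.leftModuleAlgebra.act X (CqG.star (u hπ v m i) * u hπ v n j) =
    (TensorProduct.lift (matMul.compl₁₂ _ _) (Coalgebra.comul X)) i j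
  rw [D.leftModuleAlgebra.act_prod]
  -- Both sides are linear in the coproduct, so it may be replaced by an arbitrary tensor and then
  -- by a pure one.
  generalize Coalgebra.comul (R := ℂ) X = t
  induction t using TensorProduct.induction_on with
  | zero => simp
  | add x y hx hy => simp only [map_add, hx, hy, Matrix.add_apply]
  | tmul x y =>
    change D.leftModuleAlgebra.act x (CqG.star (u hπ v m i)) *
      D.leftModuleAlgebra.act y (u hπ v n j) = _
    rw [leftAct_star_u hπ v hu, leftAct_u]
    exact sum_smul_mul_sum_smul (repMatrixHom π v (antipodeLin x)) (repMatrixHom π v y)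
      (fun k => CqG.star (u hπ v m k)) (fun l => u hπ v n l) i j

/-- As on the left, but the starred factor now comes second, so the antipode sits on the right of
the matrix unit. -/
theorem entrywise_rightAct_matN (hu : IsUnitary π) (n m : Fin N) :
    entrywise D.rightModuleAlgebra.act (matN hπ v n m) =
      matConv (scalarMat D.CqG (repMatrixHom π v).toLinearMap)
        (LinearMap.mulLeft ℂ (matN hπ v n m) ∘ₗ
          scalarMat D.CqG ((repMatrixHom π v).toLinearMap ∘ₗ HopfAlgebra.antipode ℂ)) := by
  ext1 X
  ext1 i j
  change D.rightModuleAlgebra.act X (u hπ v i m * CqG.star (u hπ v j n)) =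
    (TensorProduct.lift (matMul.compl₁₂ _ _) (Coalgebra.comul X)) i j
  rw [D.rightModuleAlgebra.act_prod]
  generalize Coalgebra.comul (R := ℂ) X = t
  induction t using TensorProduct.induction_on with
  | zero => simp
  | add x y hx hy => simp only [map_add, hx, hy, Matrix.add_apply]
  | tmul x y =>
    change D.rightModuleAlgebra.act x (u hπ v i m) *
      D.rightModuleAlgebra.act y (CqG.star (u hπ v j n)) = _
    rw [rightAct_star_u hπ v hu, rightAct_u]
    exact sum_smul_mul_sum_smul (repMatrixHom π v x) (repMatrixHom π v (antipodeLin y))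
      (fun k => u hπ v k m) (fun l => CqG.star (u hπ v l n)) i j

/-- The contragredient anti-representation `X ↦ τ(S(X))`. -/
noncomputable def antiRepOfHom (τ : D.Uq →ₐ[ℂ] Matrix (Fin N) (Fin N) ℂ) :
    D.Uqᵐᵒᵖ →ₐ[ℂ] Matrix (Fin N) (Fin N) ℂ :=
  AlgHom.ofLinearMap
    (τ.toLinearMap ∘ₗ antipodeLin ∘ₗ (MulOpposite.opLinearEquiv ℂ).symm.toLinearMap)
    (by simp) (fun X Y => by simp [antipodeLin_mul])

theorem antiRep_antiRepOfHom (τ : D.Uq →ₐ[ℂ] Matrix (Fin N) (Fin N) ℂ) :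
    antiRep (antiRepOfHom τ) = τ.toLinearMap ∘ₗ HopfAlgebra.antipode ℂ := rfl

/-- In the definitions of invariance one of the two anti-representations is precomposed with `S⁻¹`;
this undoes the antipode and leaves `τ` itself. -/
theorem antiRep_antiRepOfHom_comp_inv (τ : D.Uq →ₐ[ℂ] Matrix (Fin N) (Fin N) ℂ) :
    antiRep (antiRepOfHom τ) ∘ₗ AntipodeInverse.inv = τ.toLinearMap :=
  LinearMap.ext fun X => congrArg τ (antipode_antipodeInv X)

/-- With `τ ∘ S` as anti-representation the expression is `τ(S(X₍₁₎)) τ(X₍₂₎) N τ(S(X₍₃₎)) τ(X₍₄₎)`,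
and the antipode axiom applies on each side of `N`. No formula for `S²` is involved. -/
theorem isRightInvariant_matN (hu : IsUnitary π) (n m : Fin N) :
    IsRightInvariant D.rightModuleAlgebra (antiRepOfHom (repMatrixHom π v))
      (antiRepOfHom (repMatrixHom π v)) (matN hπ v n m) := by
  intro X
  rw [adL, antiRep_antiRepOfHom_comp_inv, antiRep_antiRepOfHom,
    entrywise_rightAct_matN hπ v hu]
  exact matConv_conj_eq_counit_smul (scalarMat_antipode_mul_id _) (scalarMat_antipode_mul_id _) _ X

/-- The action is evaluated at `S⁻²(X₍₂₎)`, so covariance involves `τ' = τ ∘ S⁻²`, which is `τ`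
precomposed with conjugation by `K`. Using `τ' ∘ S` as anti-representation gives `τ'(X₍₁₎)
τ'(S(X₍₂₎)) M τ'(X₍₃₎) τ'(S(X₍₄₎))`, where both sides cancel. -/
theorem isLeftInvariant_matM (hu : IsUnitary π) {K : D.Uqˣ}
    (hK : ∀ X : D.Uq, antipodeLin (antipodeLin X) * K = K * X) (n m : Fin N) :
    IsLeftInvariant D.leftModuleAlgebra (antiRepOfHom (conjRepMatrixHom π v K))
      (antiRepOfHom (conjRepMatrixHom π v K)) (matM hπ v n m) := by
  -- The hypothesis on `K`, taken at `S⁻²(X)`, reads `X K = K S⁻²(X)`.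
  have hinv (X : D.Uq) : D.antipodeInvSq X = (K⁻¹ : D.Uqˣ) * (X * K) := by
    have h := hK (D.antipodeInvSq X)
    rw [antipodeInvSq_apply, antipode_antipodeInv, antipode_antipodeInv] at h
    rw [h, Units.inv_mul_cancel_left, antipodeInvSq_apply]
  have h₁ : (repMatrixHom π v).toLinearMap ∘ₗ D.antipodeInvSq.toLinearMap =
      (conjRepMatrixHom π v K).toLinearMap := by
    ext1 X
    exact congrArg (repMatrixHom π v) (hinv X)
  -- `S⁻²` commutes with `S`, so the twist can be moved inside the antipode.
  have h₂ : (repMatrixHom π v).toLinearMap ∘ₗ HopfAlgebra.antipode ℂ ∘ₗ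
      D.antipodeInvSq.toLinearMap =
      (conjRepMatrixHom π v K).toLinearMap ∘ₗ HopfAlgebra.antipode ℂ := by
    ext1 X
    change repMatrixHom π v (antipodeLin (D.antipodeInvSq X)) =
      conjRepMatrixHom π v K (antipodeLin X)
    rw [conjRepMatrixHom_apply, ← hinv, antipodeInvSq_apply, antipodeInvSq_apply,
      antipode_antipodeInv, antipodeInv_antipode]
  -- The covariance law at `S⁻²(X)`: being a coalgebra map, `S⁻²` passes to both legs of the
  -- coproduct and turns `τ` into `τ'`.
  have h₃ : entrywise (D.leftModuleAlgebra.act ∘ₗ AntipodeInverse.inv ∘ₗ AntipodeInverse.inv)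
      (matM hπ v n m) = matConv
        (scalarMat D.CqG ((conjRepMatrixHom π v K).toLinearMap ∘ₗ HopfAlgebra.antipode ℂ))
        (LinearMap.mulLeft ℂ (matM hπ v n m) ∘ₗ
          scalarMat D.CqG (conjRepMatrixHom π v K).toLinearMap) := by
    have h := congrArg (fun f => f ∘ₗ D.antipodeInvSq.toLinearMap)
      (entrywise_leftAct_matM hπ v hu n m)
    rw [matConv_comp _ _ D.antipodeInvSq comul_antipodeInvSq, entrywise_comp, LinearMap.comp_assoc,
      scalarMat_comp, scalarMat_comp, LinearMap.comp_assoc, h₁, h₂] at h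
    exact h
  intro X
  rw [adR, antiRep_antiRepOfHom_comp_inv, antiRep_antiRepOfHom, h₃]
  exact matConv_conj_eq_counit_smul (scalarMat_id_mul_antipode _) (scalarMat_id_mul_antipode _) _ X

end MatrixUnits

end Datum

/-! ### Linearity of invariance in the matrix. -/

section Linear

variable {U B : Type*} [Ring U] [HopfAlgebra ℂ U] [Ring B] [Algebra ℂ B] {N K : ℕ}

theorem entrywise_sum_smul {l m κ : Type*} (T : U →ₗ[ℂ] B →ₗ[ℂ] B) (s : Finset κ) (c : κ → ℂ)
    (M : κ → Matrix l m B) :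
    entrywise T (∑ k ∈ s, c k • M k) = ∑ k ∈ s, c k • entrywise T (M k) := by
  ext X i j
  simp [entrywise, Matrix.sum_apply]

theorem matConv_sum_smul_left {l m n κ : Type*} [Fintype l] [Fintype m] [Fintype n]
    (s : Finset κ) (c : κ → ℂ) (f : κ → U →ₗ[ℂ] Matrix l m B) (g : U →ₗ[ℂ] Matrix m n B) :
    matConv (∑ k ∈ s, c k • f k) g = ∑ k ∈ s, c k • matConv (f k) g := by
  have h : TensorProduct.lift (matMul.compl₁₂ (∑ k ∈ s, c k • f k) g) =
      ∑ k ∈ s, c k • TensorProduct.lift ((matMul (B := B)).compl₁₂ (f k) g) :=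
    TensorProduct.ext' fun x y => by simp
  ext1 X
  simp [matConv, h]

theorem matConv_sum_smul_right {l m n κ : Type*} [Fintype l] [Fintype m] [Fintype n]
    (s : Finset κ) (c : κ → ℂ) (f : U →ₗ[ℂ] Matrix l m B) (g : κ → U →ₗ[ℂ] Matrix m n B) :
    matConv f (∑ k ∈ s, c k • g k) = ∑ k ∈ s, c k • matConv f (g k) := by
  have h : TensorProduct.lift (matMul.compl₁₂ f (∑ k ∈ s, c k • g k)) =
      ∑ k ∈ s, c k • TensorProduct.lift ((matMul (B := B)).compl₁₂ f (g k)) :=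
    TensorProduct.ext' fun x y => by simp
  ext1 X
  simp [matConv, h]

variable [AntipodeInverse U]

/-- For fixed anti-representations both sides of the invariance equation are linear in the matrix:
the entrywise action is linear and convolution is bilinear. -/
theorem IsRightInvariant.sum_smul {A : RightModuleAlgebra U B}
    {ρ : Uᵐᵒᵖ →ₐ[ℂ] Matrix (Fin N) (Fin N) ℂ} {σ : Uᵐᵒᵖ →ₐ[ℂ] Matrix (Fin K) (Fin K) ℂ}
    {κ : Type*} (s : Finset κ) (c : κ → ℂ) {M : κ → Matrix (Fin N) (Fin K) B}
    (h : ∀ k, IsRightInvariant A ρ σ (M k)) : IsRightInvariant A ρ σ (∑ k ∈ s, c k • M k) := by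
  intro X
  simp only [adL, entrywise_sum_smul, matConv_sum_smul_left, matConv_sum_smul_right,
    LinearMap.sum_apply, LinearMap.smul_apply, Finset.smul_sum]
  refine Finset.sum_congr rfl fun k _ => ?_
  rw [smul_comm, ← h k X]
  rfl

theorem IsLeftInvariant.sum_smul {A : LeftModuleAlgebra U B}
    {ρ : Uᵐᵒᵖ →ₐ[ℂ] Matrix (Fin N) (Fin N) ℂ} {σ : Uᵐᵒᵖ →ₐ[ℂ] Matrix (Fin K) (Fin K) ℂ}
    {κ : Type*} (s : Finset κ) (c : κ → ℂ) {M : κ → Matrix (Fin N) (Fin K) B}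
    (h : ∀ k, IsLeftInvariant A ρ σ (M k)) : IsLeftInvariant A ρ σ (∑ k ∈ s, c k • M k) := by
  intro X
  simp only [adR, entrywise_sum_smul, matConv_sum_smul_left, matConv_sum_smul_right,
    LinearMap.sum_apply, LinearMap.smul_apply, Finset.smul_sum]
  refine Finset.sum_congr rfl fun k _ => ?_
  rw [smul_comm, ← h k X]
  rfl

end Linear

/-! ### Linear combinations of matrix units and the main theorem. -/

namespace Datum

variable {ι : Type*} {D : Datum ι} {V : Type*} [NormedAddCommGroup V] [InnerProductSpace ℂ V]
  [FiniteDimensional ℂ V] {N : ℕ} {π : D.Uq →ₐ[ℂ] Module.End ℂ V} {Λ : ι → ℕ}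
  (hπ : IsIrreducibleOfHighestWeight π Λ) (v : OrthonormalBasis (Fin N) ℂ V)
  (c : Fin N → Fin N → ℂ)

/-- One sum over pairs of indices allows linearity of invariance to be applied once. -/
theorem matP_eq_sum_prod :
    matP hπ v c = ∑ k : Fin N × Fin N, c k.1 k.2 • matM hπ v k.2 k.1 :=
  (Fintype.sum_prod_type' fun m n => c m n • matM hπ v n m).symm

theorem matQ_eq_sum_prod :
    matQ hπ v c = ∑ k : Fin N × Fin N, c k.1 k.2 • matN hπ v k.2 k.1 :=
  (Fintype.sum_prod_type' fun m n => c m n • matN hπ v n m).symm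

end Datum

end QuantumGroup

theorem mainTheorem11 {𝔤 : Type*} [LieRing 𝔤] [LieAlgebra ℂ 𝔤] [FiniteDimensional ℂ 𝔤]
    [LieAlgebra.IsSimple ℂ 𝔤] (𝔥 : LieSubalgebra ℂ 𝔤) [𝔥.IsCartanSubalgebra]
    (b : (LieAlgebra.IsKilling.rootSystem 𝔥).Base) (q : ℝ) (hq0 : 0 < q) (hq1 : q ≠ 1)
    (D : QuantumGroup.Datum b.support) (hD : D = QuantumGroup.Datum.ofBase b q hq0 hq1)
    (K2ρ : D.Uqˣ) (hK2ρ : K2ρ = D.Klam (QuantumGroup.twoRho b))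
    {V : Type*} [NormedAddCommGroup V] [InnerProductSpace ℂ V] [FiniteDimensional ℂ V]
    (π : D.Uq →ₐ[ℂ] Module.End ℂ V) (Λ : b.support → ℕ)
    (hπ : QuantumGroup.Datum.IsIrreducibleOfHighestWeight π Λ)
    (hu : QuantumGroup.Datum.IsUnitary π)
    {N : ℕ} (v : OrthonormalBasis (Fin N) ℂ V) :
    (∃ ρ : D.Uqᵐᵒᵖ →ₐ[ℂ] Matrix (Fin N) (Fin N) ℂ,
      (∀ X : D.Uq, ρ (MulOpposite.op X) = QuantumGroup.Datum.repMatrix π v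
        ((K2ρ⁻¹ : D.Uqˣ) * HopfAlgebra.antipode ℂ X * K2ρ)) ∧
      (∀ m n : Fin N, QuantumGroup.IsLeftInvariant D.leftModuleAlgebra ρ ρ
        (QuantumGroup.Datum.matM hπ v n m)) ∧
      ∀ c : Fin N → Fin N → ℂ, IsIdempotentElem (QuantumGroup.Datum.matP hπ v c) →
        ∃ x : QuantumGroup.LeftK0 D.leftModuleAlgebra,
          x.IsClassOf ρ (QuantumGroup.Datum.matP hπ v c)) ∧
    (∃ ρ : D.Uqᵐᵒᵖ →ₐ[ℂ] Matrix (Fin N) (Fin N) ℂ,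
      (∀ X : D.Uq, ρ (MulOpposite.op X) = QuantumGroup.Datum.repMatrix π v
        (K2ρ * QuantumGroup.AntipodeInverse.inv X * (K2ρ⁻¹ : D.Uqˣ))) ∧
      (∀ m n : Fin N, QuantumGroup.IsRightInvariant D.rightModuleAlgebra ρ ρ
        (QuantumGroup.Datum.matN hπ v n m)) ∧
      ∀ c : Fin N → Fin N → ℂ, IsIdempotentElem (QuantumGroup.Datum.matQ hπ v c) →
        ∃ x : QuantumGroup.RightK0 D.rightModuleAlgebra,
          x.IsClassOf ρ (QuantumGroup.Datum.matQ hπ v c)) := by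
  subst hD hK2ρ
  -- The matrix `a` of the datum is the transpose of `b.cartanMatrix`, so the sum of `n_i a_ji`
  -- required here is exactly the one that equals `2`.
  have hK := QuantumGroup.Datum.antipode_sq_mul_Klam
    (D := QuantumGroup.Datum.ofBase b q hq0 hq1) (QuantumGroup.sum_twoRho_mul_cartanMatrix b)
  have hM (m n : Fin N) := QuantumGroup.Datum.isLeftInvariant_matM hπ v hu hK n m
  have hN (m n : Fin N) := QuantumGroup.Datum.isRightInvariant_matN hπ v hu n m
  -- The two anti-representations are read off from `hM` and `hN`, namely `τ' ∘ S` and `τ ∘ S`. What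
  -- remains is their closed form and the invariance of the combinations.
  refine ⟨⟨_, fun X => ?_, hM, fun c hc => ⟨_, hc, ?_, rfl⟩⟩,
    ⟨_, fun X => ?_, hN, fun c hc => ⟨_, hc, ?_, rfl⟩⟩⟩
  · rw [mul_assoc]
    rfl
  · rw [QuantumGroup.Datum.matP_eq_sum_prod]
    exact QuantumGroup.IsLeftInvariant.sum_smul _ _ fun k => hM k.1 k.2
  -- Conjugation by `K_{2ρ}` is `S²`, so `K_{2ρ} S⁻¹(X) K_{2ρ}⁻¹ = S²(S⁻¹(X)) = S(X)`.
  · rw [← hK, Units.mul_inv_cancel_right]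
    exact congrArg (QuantumGroup.Datum.repMatrixHom π v ∘ QuantumGroup.Datum.antipodeLin)
      (QuantumGroup.Datum.antipode_antipodeInv X).symm
  · rw [QuantumGroup.Datum.matQ_eq_sum_prod]
    exact QuantumGroup.IsRightInvariant.sum_smul _ _ fun k => hN k.1 k.2
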